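/- Let $n\ge 4$ be an integer and put $$\gamma=\tfrac1{2n+1},\quad \alpha=\tfrac12-\gamma,\quad \varepsilon=\tfrac1{n-1},\quad \delta=\tfrac{n+2}{n-1},\quad \kappa=\tfrac1{\sqrt\pi},\quad \kappa_3=-\tfrac{\kappa}{12},\quad \lambda=\Big(\tfrac{\delta(\delta+1)}{(2\kappa)^n}\Big)^{1/(n-1)},$$ $$\lambda_0=\frac12\,\frac{\lambda}{\kappa}\,\frac{-2n\kappa_3\delta(\delta+1)-\kappa(\delta-2\varepsilon)}{(n-1)\delta(\delta+1)+2(2\delta-1)},\qquad \delta'=\begin{cases}\tfrac12\big(\sqrt{4n\delta(\delta+1)+1}-1\big)& n\le 5,\\ 2\delta+1& n\ge 6.\end{cases}$$ Functions are defined on $\mathbf R_+=[0,\infty)$, and derivatives at $0$ are one-sided. There is a positive twice differentiable function $\eta$ on $\mathbf R_+$ with $$\eta''=(2\kappa z\eta+\eta^2)^n\ \text{ on }\mathbf R_+,\qquad \eta'(0)=-\kappa,\qquad \lim_{z\to\infty}\eta(z)=0,$$ and for every such $\eta$ the following holds. There exists a unique twice differentiable function $h\colon\mathbf R_+\to\mathbf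 R$ that satisfies $$h''+\gamma\eta+\alpha z\eta'=n\,(2\kappa z\eta+\eta^2)^{n-1}\big((2\kappa z+2\eta)h+2\kappa_3z^3\eta\big)\quad\text{on }\mathbf R_+$$ with the boundary conditions $h'(0)=0$ and $\lim_{z\to\infty}\big(h(z)-\lambda_0z^{2-\delta}\big)=0$; that is, the function $\varphi_2(z)=-\lambda_0z^{2-\delta}+h(z)$ tends to $0$ at infinity. Moreover, there are real constants $h_0,h_2$ with $$h(z)=h_0+h_2z^2+o(z^2)\qquad(z\to0^+),$$ and there is a real constant $\lambda'$ with $$h(z)=\lambda_0z^{2-\delta}+\lambda' z^{2-\delta'}+o\big(z^{2-\delta'}\big)\qquad(z\to\infty),\qquad\text{where }\delta<\delta'.$$ -/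

import Mathlib

open Set Filter Topology

namespace ReactionFront

noncomputable section

/-- The exponent `γ = 1 / (2n + 1)`. -/
def gam (n : ℕ) : ℝ := 1 / (2 * (n : ℝ) + 1)

/-- The exponent `α = 1/2 - γ`. -/
def alph (n : ℕ) : ℝ := 1 / 2 - gam n

/-- The exponent `ε = 1 / (n - 1)`. -/
def eps (n : ℕ) : ℝ := 1 / ((n : ℝ) - 1)

/-- The exponent `δ = (n + 2) / (n - 1)`. -/
def del (n : ℕ) : ℝ := ((n : ℝ) + 2) / ((n : ℝ) - 1)

/-- The exponent `δ'`. -/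
def del' (n : ℕ) : ℝ :=
  if n ≤ 5 then (Real.sqrt (4 * (n : ℝ) * del n * (del n + 1) + 1) - 1) / 2
  else 2 * del n + 1

/-- The constant `κ = 1 / √π`: the first Taylor coefficient at `0` of `y ↦ erf (y / 2)`. -/
def kap : ℝ := 1 / Real.sqrt Real.pi

/-- The constant `κ₃ = - κ / 12`: the third Taylor coefficient at `0` of `y ↦ erf (y / 2)`. -/
def kap3 : ℝ := -(1 / 12) * kap

/-- The constant `λ = (δ (δ + 1) / (2 κ) ^ n) ^ (1 / (n - 1))`. -/
def lam (n : ℕ) : ℝ :=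
  (del n * (del n + 1) / (2 * kap) ^ n) ^ (1 / ((n : ℝ) - 1))

/-- The constant `λ₀`. -/
def lam0 (n : ℕ) : ℝ :=
  1 / 2 * (lam n / kap) *
    ((-2 * (n : ℝ) * kap3 * del n * (del n + 1) - kap * (del n - 2 * eps n)) /
      (((n : ℝ) - 1) * del n * (del n + 1) + 2 * (2 * del n - 1)))

/-- The derivative of a function on the half-line `[0, ∞)`, one-sided at `0`. -/
def D (f : ℝ → ℝ) : ℝ → ℝ := derivWithin f (Ici 0)

/-- `f` is twice differentiable on `[0, ∞)` (one-sided at `0`). -/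
def TwiceDifferentiable (f : ℝ → ℝ) : Prop :=
  DifferentiableOn ℝ f (Ici 0) ∧ DifferentiableOn ℝ (D f) (Ici 0)

/-- `η`, restricted to `[0, ∞)`, is a positive solution of `η'' = (2 κ z η + η²) ^ n`
with `η'(0) = - κ` and `η(z) → 0` as `z → ∞`. -/
structure IsEta (n : ℕ) (η : ℝ → ℝ) : Prop where
  twiceDiff : TwiceDifferentiable η
  pos : ∀ z, 0 ≤ z → 0 < η z
  ode : ∀ z, 0 ≤ z → D (D η) z = (2 * kap * z * η z + η z ^ 2) ^ n
  deriv_zero : D η 0 = -kap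
  tendsto : Tendsto η atTop (𝓝 0)

/-- The function `φ₂(z) = - λ₀ z ^ (2 - δ) + h(z)`. -/
def phi2 (n : ℕ) (h : ℝ → ℝ) (z : ℝ) : ℝ := -lam0 n * z ^ (2 - del n) + h z

/-- `h`, restricted to `[0, ∞)`, solves the linear equation
`h'' + γ η + α z η' = n (2 κ z η + η²) ^ (n - 1) ((2 κ z + 2 η) h + 2 κ₃ z³ η)`
with `h'(0) = 0` and `h(z) - λ₀ z ^ (2 - δ) → 0` as `z → ∞`. -/
structure IsH (n : ℕ) (η h : ℝ → ℝ) : Prop where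
  twiceDiff : TwiceDifferentiable h
  ode : ∀ z, 0 ≤ z →
    D (D h) z + gam n * η z + alph n * z * D η z =
      (n : ℝ) * (2 * kap * z * η z + η z ^ 2) ^ (n - 1) *
        ((2 * kap * z + 2 * η z) * h z + 2 * kap3 * z ^ 3 * η z)
  deriv_zero : D h 0 = 0
  tendsto : Tendsto (phi2 n h) atTop (𝓝 0)

/-- `f(x) = ∑ i, c i * x ^ (p i) + …` near `x = 0`, with `p 0 < p 1 < … < p k`:
the remainder, divided by the last power of `x`, tends to `0` as `x → 0⁺`. -/
def ExpansionAtZero {k : ℕ} (f : ℝ → ℝ) (c p : Fin (k + 1) → ℝ) : Prop :=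
  StrictMono p ∧
    Tendsto (fun x : ℝ => 1 / x ^ p (Fin.last k) * |f x - ∑ i, c i * x ^ p i|)
      (𝓝[>] 0) (𝓝 0)

/-- `f(x) = ∑ i, c i * x ^ (- p i) + …` near `x = ∞`, with `p 0 < p 1 < … < p k`:
the remainder, multiplied by `x ^ (p k)`, tends to `0` as `x → ∞`. -/
def ExpansionAtTop {k : ℕ} (f : ℝ → ℝ) (c p : Fin (k + 1) → ℝ) : Prop :=
  StrictMono p ∧
    Tendsto (fun x : ℝ => x ^ p (Fin.last k) * |f x - ∑ i, c i * x ^ (-p i)|)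
      atTop (𝓝 0)

end

end ReactionFront

/-!
The nonlinearity `(2 κ z u + u²) ^ n` is increasing in `u ≥ 0`, and the linear equation has the form
`h'' = q h + g` with `q > 0`. Both boundary value problems therefore obey a maximum principle
(`TwiceDerivOn.nonpos`), which gives uniqueness, and both can be solved between a lower and an upper
solution by monotone iteration with the resolvent of `-d²/dz² + ω²` on the half-line
(`exists_solution_between`). For `η` the barriers are `0` and `A (z + 1) ^ (-δ)`. For `h` the
function `λ₀ (z + 1) ^ (2 - δ)` is subtracted first and the barriers are `± B (z + 1) ^ (-s)` with a
small `s > 0`; they work because `q` is bounded below by a multiple of `(z + 1) ^ (-2)`.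

The expansions at infinity rest on two-sided bounds for `η`. The equation `η'' = (2 κ z η) ^ n` has
the exact solution `λ z ^ (-δ)`, which lies above `η`, and its shifts `λ (z + b) ^ (-δ)` with large
`b` lie below `η`. Hence `r = η - λ z ^ (-δ)` is `O(z ^ (-δ - 1))`, and `r` solves an Euler equation
`z² r'' - μ (μ + 1) r = …`, where `μ (μ + 1) = n δ (δ + 1)` and the right-hand side is an explicit
multiple of `z ^ (-2 δ - 1)` plus terms quadratic in `r`. Factoring the Euler operator into two
first-order ones and integrating (`euler_asymptotics`) improves the error step by step until the
second term of the expansion appears: it is `z ^ (-μ)` when `μ < 2 δ + 1`, that is for `n ≤ 5`, and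
`z ^ (-2 δ - 1)` otherwise (`IsEta.exists_expansion`).

The coefficients `q` and `g` inherit two-term expansions. The constant `λ₀` is the one for which the
leading powers in the linear equation balance (`lam0_eq`), so `φ₂ = h - λ₀ z ^ (2 - δ)` solves an
Euler equation with the same `μ` and a right-hand side of order `z ^ (2 - δ')`, and the Euler lemma
applies again (`IsH.exists_expansionAtTop`).
-/

namespace ReactionFront

/-! ### Comparison principles on a half-line -/

/-- `w` is twice differentiable on `(a, ∞)` with derivatives `w₁` and `w₂`, and `w` and `w₁` are
continuous up to the endpoint `a`. The derivatives are carried along as explicit functions. -/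
structure TwiceDerivOn (a : ℝ) (w w₁ w₂ : ℝ → ℝ) : Prop where
  cont : ContinuousOn w (Ici a)
  cont₁ : ContinuousOn w₁ (Ici a)
  deriv : ∀ z, a < z → HasDerivAt w (w₁ z) z
  deriv₁ : ∀ z, a < z → HasDerivAt w₁ (w₂ z) z

namespace TwiceDerivOn

variable {a c : ℝ} {v v₁ v₂ w w₁ w₂ : ℝ → ℝ}

theorem sub (hw : TwiceDerivOn a w w₁ w₂) (hv : TwiceDerivOn a v v₁ v₂) :
    TwiceDerivOn a (fun z => w z - v z) (fun z => w₁ z - v₁ z) (fun z => w₂ z - v₂ z) :=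
  ⟨hw.cont.sub hv.cont, hw.cont₁.sub hv.cont₁, fun z hz => (hw.deriv z hz).sub (hv.deriv z hz),
    fun z hz => (hw.deriv₁ z hz).sub (hv.deriv₁ z hz)⟩

theorem const_mul (hw : TwiceDerivOn a w w₁ w₂) (k : ℝ) :
    TwiceDerivOn a (fun z => k * w z) (fun z => k * w₁ z) (fun z => k * w₂ z) :=
  ⟨continuousOn_const.mul hw.cont, continuousOn_const.mul hw.cont₁,
    fun z hz => (hw.deriv z hz).const_mul k, fun z hz => (hw.deriv₁ z hz).const_mul k⟩

theorem mono (hw : TwiceDerivOn a w w₁ w₂) (hac : a ≤ c) : TwiceDerivOn c w w₁ w₂ :=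
  ⟨hw.cont.mono (Ici_subset_Ici.2 hac), hw.cont₁.mono (Ici_subset_Ici.2 hac),
    fun z hz => hw.deriv z (hac.trans_lt hz), fun z hz => hw.deriv₁ z (hac.trans_lt hz)⟩

theorem of_hasDerivAt (h : ∀ z, a ≤ z → HasDerivAt w (w₁ z) z)
    (h₁ : ∀ z, a ≤ z → HasDerivAt w₁ (w₂ z) z) : TwiceDerivOn a w w₁ w₂ :=
  ⟨fun z hz => (h z hz).continuousAt.continuousWithinAt,
    fun z hz => (h₁ z hz).continuousAt.continuousWithinAt,
    fun z hz => h z hz.le, fun z hz => h₁ z hz.le⟩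

end TwiceDerivOn

theorem hasDerivAt_max_zero_pow (k : ℕ) (x : ℝ) :
    HasDerivAt (fun x : ℝ => max x 0 ^ (k + 2)) ((k + 2 : ℝ) * max x 0 ^ (k + 1)) x := by
  rcases lt_trichotomy x 0 with hx | rfl | hx
  · rw [max_eq_right hx.le]
    have : (fun x : ℝ => max x 0 ^ (k + 2)) =ᶠ[𝓝 x] fun _ => 0 := by
      filter_upwards [Iio_mem_nhds hx] with y hy
      rw [max_eq_right (le_of_lt hy)]; simp
    simpa using (hasDerivAt_const x (0 : ℝ)).congr_of_eventuallyEq this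
  · have h0 : HasDerivAt (fun x : ℝ => x ^ 2) 0 (0 : ℝ) := by simpa using hasDerivAt_pow 2 (0 : ℝ)
    rw [hasDerivAt_iff_isLittleO] at h0 ⊢
    refine Asymptotics.IsBigO.trans_isLittleO (Asymptotics.IsBigO.of_bound 1 ?_) h0
    filter_upwards [Metric.ball_mem_nhds (0 : ℝ) one_pos] with y hy
    have hy1 : |y| < 1 := by simpa using hy
    have h1 : max y 0 ≤ |y| := max_le (le_abs_self y) (abs_nonneg y)
    have h2 : 0 ≤ max y 0 := le_max_right _ _
    simp only [max_self, Real.norm_eq_abs]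
    have h3 : max y 0 ^ (k + 2) ≤ |y| ^ 2 :=
      (pow_le_pow_of_le_one h2 (h1.trans hy1.le) (by omega)).trans
        (pow_le_pow_left₀ h2 h1 2)
    simpa [abs_of_nonneg h2] using h3
  · rw [max_eq_left hx.le]
    have : (fun x : ℝ => max x 0 ^ (k + 2)) =ᶠ[𝓝 x] fun x => x ^ (k + 2) := by
      filter_upwards [Ioi_mem_nhds hx] with y hy
      rw [max_eq_left (le_of_lt hy)]
    have h := (hasDerivAt_pow (k + 2) x).congr_of_eventuallyEq this
    simpa using h

/-- Maximum principle on a half-line: a function that is convex wherever it is positive, tends to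
`0` at infinity, and at the endpoint is nonpositive or has nonnegative slope, is nonpositive.
The cube of its positive part is convex with nonnegative initial slope, hence nondecreasing. -/
theorem TwiceDerivOn.nonpos {a : ℝ} {w w₁ w₂ : ℝ → ℝ} (hw : TwiceDerivOn a w w₁ w₂)
    (hsign : ∀ z, a < z → 0 < w z → 0 ≤ w₂ z) (hb : w a ≤ 0 ∨ 0 ≤ w₁ a)
    (hlim : Tendsto w atTop (𝓝 0)) {z : ℝ} (hz : a ≤ z) : w z ≤ 0 := by
  have hp : ContinuousOn (fun z => max (w z) 0) (Ici a) := hw.cont.sup continuousOn_const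
  have hslope : MonotoneOn (fun z => (3 : ℝ) * max (w z) 0 ^ 2 * w₁ z) (Ici a) := by
    refine monotoneOn_of_hasDerivWithinAt_nonneg (convex_Ici a)
      ((continuousOn_const.mul (hp.pow 2)).mul hw.cont₁)
      (f' := fun z => 3 * (2 * max (w z) 0 * w₁ z) * w₁ z + 3 * max (w z) 0 ^ 2 * w₂ z) ?_ ?_
    · intro x hx
      rw [interior_Ici, mem_Ioi] at hx
      have h := (((hasDerivAt_max_zero_pow 0 (w x)).comp x (hw.deriv x hx)).const_mul
        (3 : ℝ)).mul (hw.deriv₁ x hx)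
      refine HasDerivAt.hasDerivWithinAt (h.congr_deriv ?_)
      simp
    · intro x hx
      rw [interior_Ici, mem_Ioi] at hx
      have h0 : 0 ≤ max (w x) 0 := le_max_right _ _
      have h1 : 0 ≤ 3 * (2 * max (w x) 0 * w₁ x) * w₁ x := by
        have := mul_nonneg h0 (mul_self_nonneg (w₁ x)); linarith
      refine add_nonneg h1 ?_
      rcases le_or_gt (w x) 0 with h | h
      · simp [max_eq_right h]
      · exact mul_nonneg (by positivity) (hsign x hx h)
  have hslope0 : 0 ≤ (3 : ℝ) * max (w a) 0 ^ 2 * w₁ a := by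
    rcases hb with h | h
    · simp [max_eq_right h]
    · positivity
  have hmono : MonotoneOn (fun z => max (w z) 0 ^ 3) (Ici a) := by
    refine monotoneOn_of_hasDerivWithinAt_nonneg (convex_Ici a) (hp.pow 3)
      (f' := fun z => 3 * max (w z) 0 ^ 2 * w₁ z) ?_ ?_
    · intro x hx
      rw [interior_Ici, mem_Ioi] at hx
      have h := (hasDerivAt_max_zero_pow 1 (w x)).comp x (hw.deriv x hx)
      refine HasDerivAt.hasDerivWithinAt (h.congr_deriv ?_)
      norm_num
    · intro x hx
      rw [interior_Ici, mem_Ioi] at hx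
      exact hslope0.trans (hslope self_mem_Ici (mem_Ici.2 hx.le) hx.le)
  have hlim3 : Tendsto (fun z => max (w z) 0 ^ 3) atTop (𝓝 0) := by
    simpa using (hlim.max (tendsto_const_nhds (x := (0 : ℝ)))).pow 3
  have hle : max (w z) 0 ^ 3 ≤ 0 := by
    refine ge_of_tendsto hlim3 ?_
    filter_upwards [eventually_ge_atTop z] with y hy
    exact hmono hz (mem_Ici.2 (le_trans hz hy)) hy
  by_contra hpos
  push Not at hpos
  rw [max_eq_left hpos.le] at hle
  exact absurd hle (not_le.2 (pow_pos hpos 3))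

theorem TwiceDerivOn.eq_zero {a : ℝ} {w w₁ w₂ : ℝ → ℝ} (hw : TwiceDerivOn a w w₁ w₂)
    (hpos : ∀ z, a < z → 0 < w z → 0 ≤ w₂ z) (hneg : ∀ z, a < z → w z < 0 → w₂ z ≤ 0)
    (hb : w₁ a = 0) (hlim : Tendsto w atTop (𝓝 0)) {z : ℝ} (hz : a ≤ z) : w z = 0 := by
  refine le_antisymm (hw.nonpos hpos (Or.inr hb.ge) hlim hz) ?_
  have h := (hw.const_mul (-1)).nonpos (fun z hz h => ?_) (Or.inr (by simp [hb]))
    (by simpa using hlim.const_mul (-1)) hz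
  · linarith
  · have := hneg z hz (by linarith); linarith

theorem hasDerivAt_exp_mul (k x : ℝ) :
    HasDerivAt (fun x => Real.exp (k * x)) (Real.exp (k * x) * k) x := by
  simpa using ((hasDerivAt_id x).const_mul k).exp

/-- Positivity for `-w'' + ω² w ≥ 0` with a Neumann condition at `0` and bounded `w`, `w'`: the
operator factors as `(ω - d/dz) (ω + d/dz)`. -/
theorem TwiceDerivOn.nonneg_of_bounded {ω C : ℝ} (hω : 0 < ω) {w w₁ w₂ : ℝ → ℝ}
    (hw : TwiceDerivOn 0 w w₁ w₂) (h : ∀ z, 0 < z → w₂ z ≤ ω ^ 2 * w z) (hb : w₁ 0 ≤ 0)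
    (hC : ∀ z, 0 ≤ z → |w z| ≤ C) (hC₁ : ∀ z, 0 ≤ z → |w₁ z| ≤ C) {z : ℝ} (hz : 0 ≤ z) :
    0 ≤ w z := by
  have hanti : AntitoneOn (fun z => Real.exp (-ω * z) * (w₁ z + ω * w z)) (Ici 0) := by
    refine antitoneOn_of_hasDerivWithinAt_nonpos (convex_Ici 0)
      ((by fun_prop : Continuous fun z => Real.exp (-ω * z)).continuousOn.mul
        (hw.cont₁.add (continuousOn_const.mul hw.cont)))
      (f' := fun z => Real.exp (-ω * z) * (w₂ z - ω ^ 2 * w z)) ?_ ?_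
    · intro x hx
      rw [interior_Ici, mem_Ioi] at hx
      have h1 := (hasDerivAt_exp_mul (-ω) x).mul ((hw.deriv₁ x hx).add ((hw.deriv x hx).const_mul ω))
      refine HasDerivAt.hasDerivWithinAt (h1.congr_deriv ?_)
      simp only [Pi.add_apply]; ring
    · intro x hx
      rw [interior_Ici, mem_Ioi] at hx
      exact mul_nonpos_of_nonneg_of_nonpos (Real.exp_pos _).le (by linarith [h x hx])
  have hlim : Tendsto (fun z => Real.exp (-ω * z) * (w₁ z + ω * w z)) atTop (𝓝 0) := by
    have h1 : Tendsto (fun z => Real.exp (-ω * z)) atTop (𝓝 0) :=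
      Real.tendsto_exp_atBot.comp (tendsto_id.const_mul_atTop_of_neg (by linarith))
    refine squeeze_zero_norm' (a := fun z => Real.exp (-ω * z) * (C + ω * C)) ?_
      (by simpa using h1.mul_const (C + ω * C))
    filter_upwards [eventually_ge_atTop 0] with x hx
    rw [Real.norm_eq_abs, abs_mul, abs_of_pos (Real.exp_pos _)]
    refine mul_le_mul_of_nonneg_left ((abs_add_le _ _).trans ?_) (Real.exp_pos _).le
    rw [abs_mul, abs_of_pos hω]
    exact add_le_add (hC₁ x hx) (mul_le_mul_of_nonneg_left (hC x hx) hω.le)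
  have hfirst : ∀ x, 0 ≤ x → 0 ≤ w₁ x + ω * w x := by
    intro x hx
    have h1 : 0 ≤ Real.exp (-ω * x) * (w₁ x + ω * w x) := by
      refine le_of_tendsto hlim ?_
      filter_upwards [eventually_ge_atTop x] with y hy
      exact hanti hx (mem_Ici.2 (hx.trans hy)) hy
    exact nonneg_of_mul_nonneg_right h1 (Real.exp_pos _)
  have hmono : MonotoneOn (fun z => Real.exp (ω * z) * w z) (Ici 0) := by
    refine monotoneOn_of_hasDerivWithinAt_nonneg (convex_Ici 0)
      ((by fun_prop : Continuous fun z => Real.exp (ω * z)).continuousOn.mul hw.cont)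
      (f' := fun z => Real.exp (ω * z) * (w₁ z + ω * w z)) ?_ ?_
    · intro x hx
      rw [interior_Ici, mem_Ioi] at hx
      refine HasDerivAt.hasDerivWithinAt (((hasDerivAt_exp_mul ω x).mul (hw.deriv x hx)).congr_deriv ?_)
      ring
    · intro x hx
      rw [interior_Ici, mem_Ioi] at hx
      exact mul_nonneg (Real.exp_pos _).le (hfirst x hx.le)
  have h0 : 0 ≤ w 0 := by
    have := hfirst 0 le_rfl
    exact nonneg_of_mul_nonneg_right (by linarith : 0 ≤ ω * w 0) hω
  have h1 := hmono self_mem_Ici (mem_Ici.2 hz) hz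
  simp only [mul_zero, Real.exp_zero, one_mul] at h1
  exact nonneg_of_mul_nonneg_right (h0.trans h1) (Real.exp_pos _)

/-! ### The resolvent of the Neumann problem and monotone iteration -/

noncomputable section

/-- The bounded solution `y` of `-y' + ω y = f`. -/
def tailMean (ω : ℝ) (f : ℝ → ℝ) (z : ℝ) : ℝ :=
  Real.exp (ω * z) * ∫ s in Ioi z, Real.exp (-ω * s) * f s

/-- The bounded solution `u` of `-u'' + ω² u = f` on the half-line with `u'(0) = b`. -/
def neumannResolvent (ω b : ℝ) (f : ℝ → ℝ) (z : ℝ) : ℝ :=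
  Real.exp (-ω * z) * ((tailMean ω f 0 - b) / ω + ∫ s in (0)..z, Real.exp (ω * s) * tailMean ω f s)

end

section Resolvent

open MeasureTheory

variable {ω b C : ℝ} {f : ℝ → ℝ}

theorem integrableOn_exp_neg_mul (hω : 0 < ω) (hf : Measurable f) (hC : ∀ z, |f z| ≤ C) (a : ℝ) :
    IntegrableOn (fun s => Real.exp (-ω * s) * f s) (Ioi a) := by
  refine Integrable.mono' ((exp_neg_integrableOn_Ioi a hω).mul_const C)
    (by fun_prop) (Eventually.of_forall fun s => ?_)
  rw [Real.norm_eq_abs, abs_mul, abs_of_pos (Real.exp_pos _)]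
  exact mul_le_mul_of_nonneg_left (hC s) (Real.exp_pos _).le

theorem abs_tailMean_le (hω : 0 < ω) (hC : ∀ z, |f z| ≤ C) (z : ℝ) :
    |tailMean ω f z| ≤ C / ω := by
  have h1 : ‖∫ s in Ioi z, Real.exp (-ω * s) * f s‖ ≤ ∫ s in Ioi z, Real.exp (-ω * s) * C := by
    refine norm_integral_le_of_norm_le ((exp_neg_integrableOn_Ioi z hω).mul_const C)
      (Eventually.of_forall fun s => ?_)
    rw [Real.norm_eq_abs, abs_mul, abs_of_pos (Real.exp_pos _)]
    exact mul_le_mul_of_nonneg_left (hC s) (Real.exp_pos _).le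
  rw [integral_mul_const, integral_exp_mul_Ioi (by linarith : -ω < 0)] at h1
  rw [tailMean, abs_mul, abs_of_pos (Real.exp_pos _)]
  refine (mul_le_mul_of_nonneg_left h1 (Real.exp_pos _).le).trans (le_of_eq ?_)
  have : Real.exp (ω * z) * Real.exp (-ω * z) = 1 := by rw [← Real.exp_add]; simp
  rw [neg_div_neg_eq]
  calc Real.exp (ω * z) * (Real.exp (-ω * z) / ω * C)
      = (Real.exp (ω * z) * Real.exp (-ω * z)) * (C / ω) := by ring
    _ = C / ω := by rw [this, one_mul]

theorem tailMean_eq (hω : 0 < ω) (hf : Measurable f) (hC : ∀ z, |f z| ≤ C) :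
    tailMean ω f = fun z => Real.exp (ω * z) * ((∫ s in Ioi 0, Real.exp (-ω * s) * f s) -
      ∫ s in (0)..z, Real.exp (-ω * s) * f s) := by
  funext z
  rw [tailMean, ← intervalIntegral.integral_interval_add_Ioi
    (integrableOn_exp_neg_mul hω hf hC 0) (integrableOn_exp_neg_mul hω hf hC z)]
  ring

theorem continuous_tailMean (hω : 0 < ω) (hf : Measurable f) (hC : ∀ z, |f z| ≤ C) :
    Continuous (tailMean ω f) := by
  rw [tailMean_eq hω hf hC]
  refine (by fun_prop : Continuous fun z => Real.exp (ω * z)).mul (continuous_const.sub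
    (intervalIntegral.continuous_primitive (fun a b => ?_) 0))
  rw [intervalIntegrable_iff]
  exact (integrableOn_exp_neg_mul hω hf hC (min a b)).mono_set
    (by rw [uIoc]; exact Ioc_subset_Ioi_self)

theorem hasDerivAt_tailMean (hω : 0 < ω) (hf : Continuous f) (hC : ∀ z, |f z| ≤ C) (z : ℝ) :
    HasDerivAt (tailMean ω f) (ω * tailMean ω f z - f z) z := by
  have hc : Continuous fun s => Real.exp (-ω * s) * f s := by fun_prop
  have h1 := (hasDerivAt_exp_mul ω z).mul
    ((hc.integral_hasStrictDerivAt 0 z).hasDerivAt.const_sub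
      (∫ s in Ioi 0, Real.exp (-ω * s) * f s))
  have h2 : Real.exp (ω * z) * Real.exp (-ω * z) = 1 := by rw [← Real.exp_add]; simp
  rw [tailMean_eq hω hf.measurable hC]
  refine h1.congr_deriv ?_
  linear_combination (-f z) * h2

theorem hasDerivAt_neumannResolvent (hω : 0 < ω) (hf : Measurable f) (hC : ∀ z, |f z| ≤ C)
    (z : ℝ) : HasDerivAt (neumannResolvent ω b f)
      (tailMean ω f z - ω * neumannResolvent ω b f z) z := by
  have hc : Continuous fun s => Real.exp (ω * s) * tailMean ω f s :=
    (by fun_prop : Continuous fun z => Real.exp (ω * z)).mul (continuous_tailMean hω hf hC)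
  have h1 := (hasDerivAt_exp_mul (-ω) z).mul
    ((hc.integral_hasStrictDerivAt 0 z).hasDerivAt.const_add ((tailMean ω f 0 - b) / ω))
  have h2 : Real.exp (ω * z) * Real.exp (-ω * z) = 1 := by rw [← Real.exp_add]; simp
  refine h1.congr_deriv ?_
  rw [neumannResolvent]
  linear_combination (tailMean ω f z) * h2

theorem abs_neumannResolvent_le (hω : 0 < ω) (hC : ∀ z, |f z| ≤ C)
    {z : ℝ} (hz : 0 ≤ z) :
    |neumannResolvent ω b f z| ≤ |(tailMean ω f 0 - b) / ω| + C / ω / ω := by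
  have hC0 : 0 ≤ C := (abs_nonneg _).trans (hC 0)
  have h1 : ‖∫ s in (0)..z, Real.exp (ω * s) * tailMean ω f s‖ ≤
      ∫ s in (0)..z, Real.exp (ω * s) * (C / ω) := by
    refine intervalIntegral.norm_integral_le_of_norm_le hz (Eventually.of_forall fun s _ => ?_)
      ((by fun_prop : Continuous fun s => Real.exp (ω * s) * (C / ω)).intervalIntegrable _ _)
    rw [Real.norm_eq_abs, abs_mul, abs_of_pos (Real.exp_pos _)]
    exact mul_le_mul_of_nonneg_left (abs_tailMean_le hω hC s) (Real.exp_pos _).le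
  have h2 : ∫ s in (0)..z, Real.exp (ω * s) * (C / ω) =
      Real.exp (ω * z) * (C / ω / ω) - C / ω / ω := by
    have := intervalIntegral.integral_eq_sub_of_hasDerivAt (a := 0) (b := z)
      (f := fun s => Real.exp (ω * s) * (C / ω / ω)) (f' := fun s => Real.exp (ω * s) * (C / ω))
      (fun s _ => ((hasDerivAt_exp_mul ω s).mul_const (C / ω / ω)).congr_deriv (by field_simp))
      ((by fun_prop : Continuous fun s => Real.exp (ω * s) * (C / ω)).intervalIntegrable _ _)
    simpa using this
  have h3 : Real.exp (-ω * z) * Real.exp (ω * z) = 1 := by rw [← Real.exp_add]; simp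
  have h4 : Real.exp (-ω * z) ≤ 1 := Real.exp_le_one_iff.2 (by nlinarith)
  have h5 : 0 ≤ C / ω / ω := by positivity
  rw [h2, Real.norm_eq_abs] at h1
  rw [neumannResolvent, abs_mul, abs_of_pos (Real.exp_pos _)]
  calc _ ≤ Real.exp (-ω * z) * (|(tailMean ω f 0 - b) / ω| +
        Real.exp (ω * z) * (C / ω / ω)) := by
        refine mul_le_mul_of_nonneg_left ((abs_add_le _ _).trans ?_) (Real.exp_pos _).le
        linarith
    _ = Real.exp (-ω * z) * |(tailMean ω f 0 - b) / ω| + C / ω / ω := by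
        linear_combination (C / ω / ω) * h3
    _ ≤ _ := by
        have := mul_le_mul_of_nonneg_right h4 (abs_nonneg ((tailMean ω f 0 - b) / ω))
        linarith

theorem tendsto_neumannResolvent (hω : 0 < ω) {F : ℕ → ℝ → ℝ} (hF : ∀ j, Measurable (F j))
    (hFC : ∀ j z, |F j z| ≤ C)
    (hlim : ∀ z, Tendsto (fun j => F j z) atTop (𝓝 (f z))) (z : ℝ) :
    Tendsto (fun j => neumannResolvent ω b (F j) z) atTop (𝓝 (neumannResolvent ω b f z)) := by
  have hC : ∀ z, |f z| ≤ C := fun z =>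
    le_of_tendsto (hlim z).abs (Eventually.of_forall fun j => hFC j z)
  have htail : ∀ z, Tendsto (fun j => tailMean ω (F j) z) atTop (𝓝 (tailMean ω f z)) := by
    intro z
    refine Tendsto.const_mul _ (tendsto_integral_of_dominated_convergence
      (fun s => Real.exp (-ω * s) * C) (fun j => ?_)
      ((exp_neg_integrableOn_Ioi z hω).mul_const C) (fun j => Eventually.of_forall fun s => ?_)
      (Eventually.of_forall fun s => (hlim s).const_mul _))
    · exact (integrableOn_exp_neg_mul hω (hF j) (hFC j) z).aestronglyMeasurable
    · rw [Real.norm_eq_abs, abs_mul, abs_of_pos (Real.exp_pos _)]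
      exact mul_le_mul_of_nonneg_left (hFC j s) (Real.exp_pos _).le
  refine Tendsto.const_mul _ ((((htail 0).sub_const b).div_const ω).add ?_)
  refine intervalIntegral.tendsto_integral_filter_of_dominated_convergence
    (fun s => Real.exp (ω * s) * (C / ω)) (Eventually.of_forall fun j => ?_)
    (Eventually.of_forall fun j => Eventually.of_forall fun s _ => ?_)
    ((by fun_prop : Continuous fun s => Real.exp (ω * s) * (C / ω)).intervalIntegrable _ _)
    (Eventually.of_forall fun s _ => (htail s).const_mul _)
  · exact ((by fun_prop : Continuous fun z => Real.exp (ω * z)).mul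
      (continuous_tailMean hω (hF j) (hFC j))).aestronglyMeasurable
  · rw [Real.norm_eq_abs, abs_mul, abs_of_pos (Real.exp_pos _)]
    exact mul_le_mul_of_nonneg_left (abs_tailMean_le hω (hFC j) s) (Real.exp_pos _).le

theorem deriv_neumannResolvent_zero (hω : 0 < ω) :
    tailMean ω f 0 - ω * neumannResolvent ω b f 0 = b := by
  simp only [neumannResolvent, mul_zero, Real.exp_zero, one_mul, intervalIntegral.integral_same,
    add_zero]
  field_simp
  ring

end Resolvent

/-- A lower solution `v` and an upper solution `V ≥ v` of `u'' = G(z, u)`, `u'(0) = b`, both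
bounded, enclose a solution, provided that `u ↦ ω² u - G(z, u)` is nondecreasing between them.
The solution is the limit of the monotone iteration `-u_{j+1}'' + ω² u_{j+1} = ω² u_j - G(z, u_j)`
started at `v`. -/
theorem exists_solution_between {G : ℝ → ℝ → ℝ} {ω b C : ℝ} {v v₁ v₂ V V₁ V₂ : ℝ → ℝ}
    (hG : ContinuousOn (Function.uncurry G) (Ici 0 ×ˢ univ)) (hω : 0 < ω)
    (hv : TwiceDerivOn 0 v v₁ v₂) (hV : TwiceDerivOn 0 V V₁ V₂)
    (hle : ∀ z, 0 ≤ z → v z ≤ V z)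
    (hlower : ∀ z, 0 < z → G z (v z) ≤ v₂ z) (hupper : ∀ z, 0 < z → V₂ z ≤ G z (V z))
    (hv0 : b ≤ v₁ 0) (hV0 : V₁ 0 ≤ b)
    (hLip : ∀ z, 0 ≤ z → ∀ x y, v z ≤ x → x ≤ y → y ≤ V z → G z y - G z x ≤ ω ^ 2 * (y - x))
    (hGC : ∀ z, 0 ≤ z → ∀ x, v z ≤ x → x ≤ V z → |G z x| ≤ C)
    (hvC : ∀ z, 0 ≤ z → |v z| ≤ C) (hvC₁ : ∀ z, 0 ≤ z → |v₁ z| ≤ C)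
    (hVC : ∀ z, 0 ≤ z → |V z| ≤ C) (hVC₁ : ∀ z, 0 ≤ z → |V₁ z| ≤ C) :
    ∃ u u₁ : ℝ → ℝ, (∀ z, 0 ≤ z → HasDerivAt u (u₁ z) z) ∧
      (∀ z, 0 ≤ z → HasDerivAt u₁ (G z (u z)) z) ∧ u₁ 0 = b ∧
      ∀ z, 0 ≤ z → v z ≤ u z ∧ u z ≤ V z := by
  -- the right-hand side, extended to the whole line by its value at `0`
  let Φ : (ℝ → ℝ) → ℝ → ℝ := fun w z => ω ^ 2 * w (max z 0) - G (max z 0) (w (max z 0))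
  let Op : (ℝ → ℝ) → ℝ → ℝ := fun w => neumannResolvent ω b (Φ w)
  let Good : (ℝ → ℝ) → Prop := fun w =>
    ContinuousOn w (Ici 0) ∧ ∀ z, 0 ≤ z → v z ≤ w z ∧ w z ≤ V z
  let K := ω ^ 2 * C + C
  have hΦcont : ∀ w, ContinuousOn w (Ici 0) → Continuous (Φ w) := by
    intro w hw
    have h1 : Continuous fun z : ℝ => w (max z 0) :=
      hw.comp_continuous (by fun_prop) fun z => mem_Ici.2 (le_max_right z 0)
    have h2 : Continuous fun z : ℝ => G (max z 0) (w (max z 0)) :=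
      hG.comp_continuous (f := fun z : ℝ => (max z 0, w (max z 0)))
        ((by fun_prop : Continuous fun z : ℝ => max z 0).prodMk h1)
        fun z => ⟨mem_Ici.2 (le_max_right z 0), mem_univ _⟩
    exact (h1.const_mul _).sub h2
  have hΦK : ∀ w : ℝ → ℝ, (∀ z, 0 ≤ z → v z ≤ w z ∧ w z ≤ V z) → ∀ z, |Φ w z| ≤ K := by
    intro w hw z
    have h0 : (0 : ℝ) ≤ max z 0 := le_max_right _ _
    have h1 := hw _ h0
    have h2 : |w (max z 0)| ≤ C := abs_le.2
      ⟨(abs_le.1 (hvC _ h0)).1.trans h1.1, h1.2.trans (abs_le.1 (hVC _ h0)).2⟩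
    refine (abs_sub _ _).trans (add_le_add ?_ (hGC _ h0 _ h1.1 h1.2))
    rw [abs_mul, abs_of_pos (by positivity : 0 < ω ^ 2)]
    exact mul_le_mul_of_nonneg_left h2 (by positivity)
  have hTD : ∀ w, Good w → TwiceDerivOn 0 (Op w)
      (fun z => tailMean ω (Φ w) z - ω * Op w z) (fun z => ω ^ 2 * Op w z - Φ w z) := by
    intro w hw
    have hc := hΦcont w hw.1
    have hd := hasDerivAt_neumannResolvent (b := b) hω hc.measurable (hΦK w hw.2)
    refine TwiceDerivOn.of_hasDerivAt (fun z _ => hd z) fun z _ => ?_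
    refine ((hasDerivAt_tailMean hω hc (hΦK w hw.2) z).sub ((hd z).const_mul ω)).congr_deriv ?_
    simp only [Op]; ring
  have hbd : ∀ w, Good w → ∃ B, ∀ z, 0 ≤ z → |Op w z| ≤ B ∧
      |tailMean ω (Φ w) z - ω * Op w z| ≤ B := by
    intro w hw
    obtain ⟨B, hB⟩ : ∃ B, ∀ z, 0 ≤ z → |Op w z| ≤ B :=
      ⟨_, fun z hz => abs_neumannResolvent_le hω (hΦK w hw.2) hz⟩
    refine ⟨max B (K / ω + ω * B), fun z hz => ⟨(hB z hz).trans (le_max_left _ _), ?_⟩⟩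
    refine ((abs_sub _ _).trans (add_le_add (abs_tailMean_le hω (hΦK w hw.2) z) ?_)).trans
      (le_max_right _ _)
    rw [abs_mul, abs_of_pos hω]
    exact mul_le_mul_of_nonneg_left (hB z hz) hω.le
  have hb0 : ∀ w, tailMean ω (Φ w) 0 - ω * Op w 0 = b := fun w => deriv_neumannResolvent_zero hω
  -- comparison of two functions, one of which may be `v` or `V`
  have hcmp : ∀ p p₁ p₂ q q₁ q₂ : ℝ → ℝ, TwiceDerivOn 0 p p₁ p₂ → TwiceDerivOn 0 q q₁ q₂ →
      (∃ B, ∀ z, 0 ≤ z → |p z| ≤ B ∧ |p₁ z| ≤ B) → (∃ B, ∀ z, 0 ≤ z → |q z| ≤ B ∧ |q₁ z| ≤ B) →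
      q₁ 0 ≤ p₁ 0 → (∀ z, 0 < z → q₂ z - p₂ z ≤ ω ^ 2 * (q z - p z)) →
      ∀ z, 0 ≤ z → p z ≤ q z := by
    rintro p p₁ p₂ q q₁ q₂ hp hq ⟨B, hB⟩ ⟨B', hB'⟩ h0 h2 z hz
    have := (hq.sub hp).nonneg_of_bounded (C := B' + B) hω h2 (by linarith)
      (fun z hz => (abs_sub _ _).trans (add_le_add (hB' z hz).1 (hB z hz).1))
      (fun z hz => (abs_sub _ _).trans (add_le_add (hB' z hz).2 (hB z hz).2)) hz
    linarith
  have hΦmono : ∀ w w' : ℝ → ℝ, (∀ z, 0 ≤ z → v z ≤ w z) → (∀ z, 0 ≤ z → w z ≤ w' z) →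
      (∀ z, 0 ≤ z → w' z ≤ V z) → ∀ z, 0 ≤ z → Φ w z ≤ Φ w' z := by
    intro w w' h1 h2 h3 z hz
    have := hLip z hz _ _ (h1 z hz) (h2 z hz) (h3 z hz)
    simp only [Φ, max_eq_left hz]
    linarith
  have hmono : ∀ w w', Good w → Good w' → (∀ z, 0 ≤ z → w z ≤ w' z) →
      ∀ z, 0 ≤ z → Op w z ≤ Op w' z := by
    intro w w' hw hw' hww
    refine hcmp _ _ _ _ _ _ (hTD w hw) (hTD w' hw') (hbd w hw) (hbd w' hw') ?_ fun z hz => ?_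
    · rw [hb0, hb0]
    · have := hΦmono w w' (fun z hz => (hw.2 z hz).1) hww (fun z hz => (hw'.2 z hz).2) z hz.le
      linarith
  have hgv : Good v := ⟨hv.cont, fun z hz => ⟨le_rfl, hle z hz⟩⟩
  have hgV : Good V := ⟨hV.cont, fun z hz => ⟨hle z hz, le_rfl⟩⟩
  have hvOp : ∀ z, 0 ≤ z → v z ≤ Op v z := by
    refine hcmp _ _ _ _ _ _ hv (hTD v hgv) ⟨C, fun z hz => ⟨hvC z hz, hvC₁ z hz⟩⟩
      (hbd v hgv) ?_ fun z hz => ?_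
    · rw [hb0]; exact hv0
    · have := hlower z hz
      simp only [Φ, max_eq_left hz.le]
      linarith
  have hVOp : ∀ z, 0 ≤ z → Op V z ≤ V z := by
    refine hcmp _ _ _ _ _ _ (hTD V hgV) hV (hbd V hgV)
      ⟨C, fun z hz => ⟨hVC z hz, hVC₁ z hz⟩⟩ ?_ fun z hz => ?_
    · rw [hb0]; exact hV0
    · have := hupper z hz
      simp only [Φ, max_eq_left hz.le]
      linarith
  have hOpGood : ∀ w, Good w → Good (Op w) := fun w hw =>
    ⟨(hTD w hw).cont, fun z hz =>
      ⟨(hvOp z hz).trans (hmono v w hgv hw (fun z hz => (hw.2 z hz).1) z hz),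
        (hmono w V hw hgV (fun z hz => (hw.2 z hz).2) z hz).trans (hVOp z hz)⟩⟩
  let U : ℕ → ℝ → ℝ := fun j => Op^[j] v
  have hUsucc : ∀ j, U (j + 1) = Op (U j) := fun j => Function.iterate_succ_apply' Op j v
  have hUgood : ∀ j, Good (U j) := by
    intro j
    induction j with
    | zero => exact hgv
    | succ j ih => rw [hUsucc]; exact hOpGood _ ih
  have hUmono : ∀ j z, 0 ≤ z → U j z ≤ U (j + 1) z := by
    intro j
    induction j with
    | zero => exact hvOp
    | succ j ih =>
      rw [hUsucc, hUsucc (j + 1)]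
      exact hmono _ _ (hUgood j) (hUgood (j + 1)) ih
  let u : ℝ → ℝ := fun z => ⨆ j, U j z
  have hUlim : ∀ z, 0 ≤ z → Tendsto (fun j => U j z) atTop (𝓝 (u z)) := fun z hz =>
    tendsto_atTop_ciSup (monotone_nat_of_le_succ fun j => hUmono j z hz)
      ⟨V z, by rintro _ ⟨j, rfl⟩; exact ((hUgood j).2 z hz).2⟩
  have hubd : ∀ z, 0 ≤ z → v z ≤ u z ∧ u z ≤ V z := fun z hz =>
    ⟨ge_of_tendsto (hUlim z hz) (Eventually.of_forall fun j => ((hUgood j).2 z hz).1),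
      le_of_tendsto (hUlim z hz) (Eventually.of_forall fun j => ((hUgood j).2 z hz).2)⟩
  have hΦlim : ∀ z, Tendsto (fun j => Φ (U j) z) atTop (𝓝 (Φ u z)) := by
    intro z
    have h0 : (0 : ℝ) ≤ max z 0 := le_max_right _ _
    refine ((hUlim _ h0).const_mul _).sub ?_
    have h1 : Continuous fun x => G (max z 0) x :=
      hG.comp_continuous (f := fun x : ℝ => (max z 0, x)) (by fun_prop) fun x => ⟨h0, mem_univ _⟩
    exact (h1.tendsto _).comp (hUlim _ h0)
  have hΦmeas : Measurable (Φ u) := measurable_of_tendsto_metrizable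
    (fun j => (hΦcont _ (hUgood j).1).measurable) (tendsto_pi_nhds.2 hΦlim)
  have hfix : ∀ z, 0 ≤ z → u z = Op u z := by
    intro z hz
    refine tendsto_nhds_unique ((hUlim z hz).comp (tendsto_add_atTop_nat 1)) ?_
    have := tendsto_neumannResolvent (b := b) hω (fun j => (hΦcont _ (hUgood j).1).measurable)
      (fun j => hΦK _ (hUgood j).2) hΦlim z
    refine this.congr fun j => ?_
    simp only [Function.comp, hUsucc, Op]
  have hd : ∀ z, HasDerivAt (Op u) (tailMean ω (Φ u) z - ω * Op u z) z :=
    hasDerivAt_neumannResolvent hω hΦmeas (hΦK u hubd)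
  have hOpcont : Continuous (Op u) := continuous_iff_continuousAt.2 fun z => (hd z).continuousAt
  have hucont : ContinuousOn u (Ici 0) := hOpcont.continuousOn.congr fun z hz => hfix z hz
  refine ⟨Op u, fun z => tailMean ω (Φ u) z - ω * Op u z, fun z _ => hd z, fun z hz => ?_,
    hb0 u, fun z hz => by rw [← hfix z hz]; exact hubd z hz⟩
  refine ((hasDerivAt_tailMean hω (hΦcont u hucont) (hΦK u hubd) z).sub
    ((hd z).const_mul ω)).congr_deriv ?_
  have h1 : Φ u z = ω ^ 2 * Op u z - G z (Op u z) := by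
    simp only [Φ, max_eq_left hz, hfix z hz]
  rw [h1]; ring

/-! ### Asymptotics of solutions of Euler equations -/

open Asymptotics

theorem isBigO_rpow_rpow_atTop {p q : ℝ} (h : p ≤ q) :
    (fun z : ℝ => z ^ p) =O[atTop] fun z : ℝ => z ^ q := by
  refine IsBigO.of_bound 1 ?_
  filter_upwards [eventually_ge_atTop 1] with z hz
  have h0 : 0 ≤ z := zero_le_one.trans hz
  rw [Real.norm_of_nonneg (Real.rpow_nonneg h0 _), Real.norm_of_nonneg (Real.rpow_nonneg h0 _),
    one_mul]
  exact Real.rpow_le_rpow_of_exponent_le hz h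

theorem isBigO_rpow_mul {f g : ℝ → ℝ} {p q r : ℝ} (hf : f =O[atTop] fun z : ℝ => z ^ p)
    (hg : g =O[atTop] fun z : ℝ => z ^ q) (h : p + q = r) :
    (fun z => f z * g z) =O[atTop] fun z : ℝ => z ^ r := by
  refine (hf.mul hg).congr' EventuallyEq.rfl ?_
  filter_upwards [eventually_gt_atTop 0] with z hz
  rw [← h, Real.rpow_add hz]

theorem isBigO_const_rpow {p : ℝ} (hp : 0 ≤ p) (c : ℝ) :
    (fun _ : ℝ => c) =O[atTop] fun z : ℝ => z ^ p := by
  refine (isBigO_const_const c (one_ne_zero (α := ℝ)) _).trans ?_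
  simpa using isBigO_rpow_rpow_atTop hp

theorem tendsto_zero_of_isBigO_rpow {f : ℝ → ℝ} {p : ℝ} (hp : p < 0)
    (hf : f =O[atTop] fun z : ℝ => z ^ p) : Tendsto f atTop (𝓝 0) := by
  refine hf.trans_tendsto ?_
  simpa using tendsto_rpow_neg_atTop (neg_pos.2 hp)

/-- Integration of a bound on the derivative; for `p < 0` the constant is the limit of `f`, for
`p > 0` it is immaterial. -/
theorem exists_isBigO_sub_of_deriv {f f' : ℝ → ℝ} {p : ℝ} (hp : p ≠ 0)
    (hd : ∀ᶠ z in atTop, HasDerivAt f (f' z) z)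
    (hf' : f' =O[atTop] fun z : ℝ => z ^ (p - 1)) :
    ∃ L : ℝ, (fun z => f z - L) =O[atTop] fun z : ℝ => z ^ p := by
  obtain ⟨K, hK⟩ := hf'.bound
  obtain ⟨A, hA⟩ := eventually_atTop.1 ((hd.and hK).and (eventually_ge_atTop 1))
  have hA1 : 1 ≤ A := (hA A le_rfl).2
  have hpow : ∀ z, A ≤ z → HasDerivAt (fun z : ℝ => K / p * z ^ p) (K * z ^ (p - 1)) z := by
    intro z hz
    have h := (Real.hasDerivAt_rpow_const (p := p)
      (Or.inl (by linarith : z ≠ 0))).const_mul (K / p)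
    exact h.congr_deriv (by field_simp)
  have hbound : ∀ z, A ≤ z → |f' z| ≤ K * z ^ (p - 1) := by
    intro z hz
    have h := (hA z hz).1.2
    rwa [Real.norm_eq_abs, Real.norm_of_nonneg (Real.rpow_nonneg (by linarith) _)] at h
  have hmono : MonotoneOn (fun z => f z + K / p * z ^ p) (Ici A) := by
    refine monotoneOn_of_hasDerivWithinAt_nonneg (convex_Ici A)
      (f' := fun z => f' z + K * z ^ (p - 1)) (fun z hz =>
        ((hA z hz).1.1.add (hpow z hz)).continuousAt.continuousWithinAt) ?_ ?_
    · intro z hz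
      rw [interior_Ici, mem_Ioi] at hz
      exact ((hA z hz.le).1.1.add (hpow z hz.le)).hasDerivWithinAt
    · intro z hz
      rw [interior_Ici, mem_Ioi] at hz
      linarith [(abs_le.1 (hbound z hz.le)).1]
  have hanti : AntitoneOn (fun z => f z - K / p * z ^ p) (Ici A) := by
    refine antitoneOn_of_hasDerivWithinAt_nonpos (convex_Ici A)
      (f' := fun z => f' z - K * z ^ (p - 1)) (fun z hz =>
        ((hA z hz).1.1.sub (hpow z hz)).continuousAt.continuousWithinAt) ?_ ?_
    · intro z hz
      rw [interior_Ici, mem_Ioi] at hz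
      exact ((hA z hz.le).1.1.sub (hpow z hz.le)).hasDerivWithinAt
    · intro z hz
      rw [interior_Ici, mem_Ioi] at hz
      linarith [(abs_le.1 (hbound z hz.le)).2]
  have hK0 : 0 ≤ K := by
    have h := (abs_nonneg _).trans (hbound A le_rfl)
    exact nonneg_of_mul_nonneg_left h (Real.rpow_pos_of_pos (by linarith) _)
  rcases lt_or_gt_of_ne hp with hp | hp
  · have hKp : K / p ≤ 0 := div_nonpos_of_nonneg_of_nonpos hK0 hp.le
    have hzp : Tendsto (fun z : ℝ => K / p * z ^ p) atTop (𝓝 0) := by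
      simpa using (tendsto_zero_of_isBigO_rpow hp (isBigO_refl _ _)).const_mul (K / p)
    have hbdd : BddAbove (range fun z : ℝ => f (max z A) + K / p * (max z A) ^ p) := by
      refine ⟨f A - K / p * A ^ p, ?_⟩
      rintro _ ⟨z, rfl⟩
      have h1 := hanti self_mem_Ici (mem_Ici.2 (le_max_right z A)) (le_max_right z A)
      have h2 : K / p * (max z A) ^ p ≤ 0 :=
        mul_nonpos_of_nonpos_of_nonneg hKp
          (Real.rpow_nonneg (by linarith [le_max_right z A]) _)
      simp only at h1 ⊢
      linarith
    have hG := tendsto_atTop_ciSup (f := fun z : ℝ => f (max z A) + K / p * (max z A) ^ p)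
      (fun x y hxy => hmono (mem_Ici.2 (le_max_right x A)) (mem_Ici.2 (le_max_right y A))
        (max_le_max_right A hxy)) hbdd
    set L := ⨆ z : ℝ, f (max z A) + K / p * (max z A) ^ p
    have hG' : Tendsto (fun z => f z + K / p * z ^ p) atTop (𝓝 L) := by
      refine hG.congr' ?_
      filter_upwards [eventually_ge_atTop A] with z hz
      rw [max_eq_left hz]
    have hH' : Tendsto (fun z => f z - K / p * z ^ p) atTop (𝓝 L) := by
      have := (hG'.sub hzp).sub hzp
      simp only [sub_zero] at this
      exact this.congr fun z => by ring
    refine ⟨L, IsBigO.of_bound (-(K / p)) ?_⟩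
    filter_upwards [eventually_ge_atTop A] with z hz
    rw [Real.norm_eq_abs, Real.norm_of_nonneg (Real.rpow_nonneg (by linarith) _), abs_le]
    have h1 : f z + K / p * z ^ p ≤ L := ge_of_tendsto hG' (by
      filter_upwards [eventually_ge_atTop z] with y hy
      exact hmono (mem_Ici.2 hz) (mem_Ici.2 (hz.trans hy)) hy)
    have h2 : L ≤ f z - K / p * z ^ p := le_of_tendsto hH' (by
      filter_upwards [eventually_ge_atTop z] with y hy
      exact hanti (mem_Ici.2 hz) (mem_Ici.2 (hz.trans hy)) hy)
    constructor <;> linarith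
  · refine ⟨0, ?_⟩
    have hC : (fun z => |f A| + |K / p * A ^ p| + K / p * z ^ p) =O[atTop] fun z : ℝ => z ^ p :=
      (isBigO_const_rpow hp.le _).add ((isBigO_refl _ _).const_mul_left _)
    refine IsBigO.trans (IsBigO.of_bound 1 ?_) hC
    filter_upwards [eventually_ge_atTop A] with z hz
    have h1 := hmono self_mem_Ici (mem_Ici.2 hz) hz
    have h2 := hanti self_mem_Ici (mem_Ici.2 hz) hz
    have h3 : 0 ≤ K / p * z ^ p :=
      mul_nonneg (div_nonneg hK0 hp.le) (Real.rpow_nonneg (by linarith) _)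
    simp only at h1 h2
    rw [sub_zero, one_mul, Real.norm_eq_abs, Real.norm_of_nonneg (by positivity), abs_le]
    constructor
    · linarith [neg_abs_le (f A), neg_abs_le (K / p * A ^ p)]
    · linarith [le_abs_self (f A), neg_abs_le (K / p * A ^ p)]

/-- Decaying solutions of the perturbed Euler equation `z² r'' - m (m + 1) r = O(z⁻ᵖ)`, whose
homogeneous solutions are `z⁻ᵐ` and `z ^ (m + 1)`. The operator factors into the two first-order
operators `z d/dz - (m + 1)` and `z d/dz + m`, each inverted by one integration. -/
theorem euler_asymptotics {m p : ℝ} {r r₁ r₂ : ℝ → ℝ} (hm : 0 < m) (hpm : p ≠ m)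
    (hp : -(m + 1) < p) (hr : ∀ᶠ z in atTop, HasDerivAt r (r₁ z) z)
    (hr₁ : ∀ᶠ z in atTop, HasDerivAt r₁ (r₂ z) z) (hlim : Tendsto r atTop (𝓝 0))
    (he : (fun z => z ^ 2 * r₂ z - m * (m + 1) * r z) =O[atTop] fun z : ℝ => z ^ (-p)) :
    ∃ C : ℝ, ((fun z => r z - C * z ^ (-m)) =O[atTop] fun z : ℝ => z ^ (-p)) ∧
      (fun z => z * r₁ z + m * (C * z ^ (-m))) =O[atTop] fun z : ℝ => z ^ (-p) := by
  obtain ⟨L, hL⟩ := exists_isBigO_sub_of_deriv (p := -m - 1 - p)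
    (f := fun z => z ^ (-m - 1) * (z * r₁ z + m * r z))
    (f' := fun z => z ^ (-m - 2) * (z ^ 2 * r₂ z - m * (m + 1) * r z)) (by linarith) (by
      filter_upwards [hr, hr₁, eventually_gt_atTop 0] with z h h1 hz
      have h3 := (Real.hasDerivAt_rpow_const (p := -m - 1) (Or.inl hz.ne')).mul
        (((hasDerivAt_id z).mul h1).add (h.const_mul m))
      refine h3.congr_deriv ?_
      have e1 : z ^ (-m - 1) = z ^ (-m - 2) * z := by
        rw [← Real.rpow_add_one hz.ne']; ring_nf
      have e2 : z ^ (-m - 1 - 1) = z ^ (-m - 2) := by ring_nf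
      simp only [id, Pi.add_apply, Pi.mul_apply]
      rw [e2, e1]; ring)
    (isBigO_rpow_mul (isBigO_refl _ _) he (by ring))
  obtain ⟨C, hC⟩ := exists_isBigO_sub_of_deriv (p := m - p)
    (f := fun z => z ^ m * r z - L / (2 * m + 1) * z ^ (2 * m + 1))
    (f' := fun z => z ^ (2 * m) * (z ^ (-m - 1) * (z * r₁ z + m * r z) - L))
    (sub_ne_zero.2 hpm.symm) (by
      filter_upwards [hr, eventually_gt_atTop 0] with z h hz
      have h3 := ((Real.hasDerivAt_rpow_const (p := m) (Or.inl hz.ne')).mul h).sub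
        ((Real.hasDerivAt_rpow_const (p := 2 * m + 1) (Or.inl hz.ne')).const_mul
          (L / (2 * m + 1)))
      refine h3.congr_deriv ?_
      have e1 : z ^ (2 * m) * z ^ (-m - 1) = z ^ (m - 1) := by
        rw [← Real.rpow_add hz]; ring_nf
      have e2 : z ^ m = z ^ (m - 1) * z := by
        rw [← Real.rpow_add_one hz.ne']; ring_nf
      have e3 : z ^ (2 * m + 1 - 1) = z ^ (2 * m) := by ring_nf
      have e4 : L / (2 * m + 1) * (2 * m + 1) = L := div_mul_cancel₀ _ (by linarith)
      rw [e2, e3]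
      linear_combination (-(z * r₁ z + m * r z)) * e1 - z ^ (2 * m) * e4)
    (isBigO_rpow_mul (isBigO_refl _ _) hL (by ring))
  have hr' : (fun z => r z - L / (2 * m + 1) * z ^ (m + 1) - C * z ^ (-m)) =O[atTop]
      fun z : ℝ => z ^ (-p) := by
    refine (isBigO_rpow_mul (isBigO_refl (fun z : ℝ => z ^ (-m)) _) hC
      (by ring : -m + (m - p) = -p)).congr' ?_ EventuallyEq.rfl
    filter_upwards [eventually_gt_atTop 0] with z hz
    have e1 : z ^ (-m) * z ^ m = 1 := by rw [← Real.rpow_add hz]; simp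
    have e2 : z ^ (-m) * z ^ (2 * m + 1) = z ^ (m + 1) := by
      rw [← Real.rpow_add hz]; ring_nf
    linear_combination (r z) * e1 - L / (2 * m + 1) * e2
  -- the growing homogeneous solution is absent because `r` tends to `0`
  have hL0 : L = 0 := by
    have h1 : Tendsto (fun z : ℝ => z ^ (-(m + 1))) atTop (𝓝 0) :=
      tendsto_rpow_neg_atTop (by linarith)
    have h2 := tendsto_zero_of_isBigO_rpow (by linarith)
      (isBigO_rpow_mul (isBigO_refl (fun z : ℝ => z ^ (-(m + 1))) _) hr' rfl)
    have h3 := (h1.mul hlim).sub h2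
    have h4 : Tendsto (fun z : ℝ => C * z ^ (-(2 * m + 1))) atTop (𝓝 0) := by
      simpa using (tendsto_rpow_neg_atTop (by linarith : 0 < 2 * m + 1)).const_mul C
    have h5 : Tendsto (fun _ : ℝ => L / (2 * m + 1)) atTop (𝓝 0) := by
      have := h3.sub h4
      simp only [mul_zero, sub_zero] at this
      refine this.congr' ?_
      filter_upwards [eventually_gt_atTop 0] with z hz
      have e1 : z ^ (-(m + 1)) * z ^ (m + 1) = 1 := by rw [← Real.rpow_add hz]; simp
      have e2 : z ^ (-(m + 1)) * z ^ (-m) = z ^ (-(2 * m + 1)) := by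
        rw [← Real.rpow_add hz]; ring_nf
      linear_combination L / (2 * m + 1) * e1 + C * e2
    have h6 := tendsto_nhds_unique h5 tendsto_const_nhds
    rcases div_eq_zero_iff.1 h6.symm with h | h
    · exact h
    · linarith
  subst hL0
  simp only [zero_div, zero_mul, sub_zero] at hr' hL
  refine ⟨C, hr', ?_⟩
  have h1 : (fun z => z * r₁ z + m * r z) =O[atTop] fun z : ℝ => z ^ (-p) := by
    refine (isBigO_rpow_mul (isBigO_refl (fun z : ℝ => z ^ (m + 1)) _) hL
      (by ring : m + 1 + (-m - 1 - p) = -p)).congr' ?_ EventuallyEq.rfl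
    filter_upwards [eventually_gt_atTop 0] with z hz
    have e1 : z ^ (m + 1) * z ^ (-m - 1) = 1 := by rw [← Real.rpow_add hz]; ring_nf; simp
    rw [← mul_assoc, e1, one_mul]
  refine (h1.sub (hr'.const_mul_left m)).congr_left fun z => ?_
  ring

/-- In the subcritical range `p < m` the homogeneous solution is absorbed by the error. -/
theorem euler_asymptotics_of_lt {m p : ℝ} {r r₁ r₂ : ℝ → ℝ} (hm : 0 < m) (hpm : p < m)
    (hp : -(m + 1) < p) (hr : ∀ᶠ z in atTop, HasDerivAt r (r₁ z) z)
    (hr₁ : ∀ᶠ z in atTop, HasDerivAt r₁ (r₂ z) z) (hlim : Tendsto r atTop (𝓝 0))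
    (he : (fun z => z ^ 2 * r₂ z - m * (m + 1) * r z) =O[atTop] fun z : ℝ => z ^ (-p)) :
    (r =O[atTop] fun z : ℝ => z ^ (-p)) ∧
      (fun z => z * r₁ z) =O[atTop] fun z : ℝ => z ^ (-p) := by
  obtain ⟨C, h1, h2⟩ := euler_asymptotics hm hpm.ne hp hr hr₁ hlim he
  have h3 : (fun z : ℝ => C * z ^ (-m)) =O[atTop] fun z : ℝ => z ^ (-p) :=
    (isBigO_rpow_rpow_atTop (by linarith)).const_mul_left C
  exact ⟨(h1.add h3).congr_left fun z => by ring,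
    (h2.sub (h3.const_mul_left m)).congr_left fun z => by ring⟩

/-- A term `c z⁻ᵖ` with `p ≠ m`, `p < q < m` on the right-hand side of the Euler equation
contributes a multiple of `z⁻ᵖ`. -/
theorem euler_asymptotics_forced {m p q c : ℝ} {r r₁ r₂ : ℝ → ℝ} (hp : 0 < p) (hpq : p < q)
    (hqm : q < m) (hr : ∀ᶠ z in atTop, HasDerivAt r (r₁ z) z)
    (hr₁ : ∀ᶠ z in atTop, HasDerivAt r₁ (r₂ z) z) (hlim : Tendsto r atTop (𝓝 0))
    (he : (fun z => z ^ 2 * r₂ z - m * (m + 1) * r z - c * z ^ (-p)) =O[atTop]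
      fun z : ℝ => z ^ (-q)) :
    ∃ C : ℝ, ((fun z => r z - C * z ^ (-p)) =O[atTop] fun z : ℝ => z ^ (-q)) ∧
      (fun z => z * r₁ z + p * (C * z ^ (-p))) =O[atTop] fun z : ℝ => z ^ (-q) := by
  have hne : p * (p + 1) - m * (m + 1) ≠ 0 := by nlinarith
  set C := c / (p * (p + 1) - m * (m + 1)) with hCdef
  have hC : C * (p * (p + 1) - m * (m + 1)) = c := div_mul_cancel₀ _ hne
  have hpow : ∀ z : ℝ, 0 < z → z ^ (-p) = z ^ (-p - 2) * z ^ 2 := by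
    intro z hz
    rw [← Real.rpow_natCast z 2, ← Real.rpow_add hz]; norm_num
  have hpow1 : ∀ z : ℝ, 0 < z → z ^ (-p) = z ^ (-p - 1) * z := by
    intro z hz
    rw [← Real.rpow_add_one hz.ne']; ring_nf
  have h := euler_asymptotics_of_lt (m := m) (p := q) (r := fun z => r z - C * z ^ (-p))
    (r₁ := fun z => r₁ z - C * (-p * z ^ (-p - 1)))
    (r₂ := fun z => r₂ z - C * (-p * ((-p - 1) * z ^ (-p - 2)))) (by linarith) hqm (by linarith)
    (by
      filter_upwards [hr, eventually_gt_atTop 0] with z h hz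
      exact h.sub ((Real.hasDerivAt_rpow_const (Or.inl hz.ne')).const_mul C))
    (by
      filter_upwards [hr₁, eventually_gt_atTop 0] with z h hz
      have h1 := h.sub (((Real.hasDerivAt_rpow_const (p := -p - 1)
        (Or.inl hz.ne')).const_mul (-p)).const_mul C)
      refine h1.congr_deriv ?_
      ring_nf)
    (by simpa using hlim.sub ((tendsto_rpow_neg_atTop hp).const_mul C))
    (he.congr' (by
      filter_upwards [eventually_gt_atTop 0] with z hz
      linear_combination z ^ (-p) * hC - C * p * (p + 1) * hpow z hz) EventuallyEq.rfl)
  refine ⟨C, h.1, h.2.congr' ?_ EventuallyEq.rfl⟩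
  filter_upwards [eventually_gt_atTop 0] with z hz
  linear_combination (-p * C) * hpow1 z hz

/-! ### Two-term expansions at infinity -/

/-- `f(z) = a + c z^{-ρ} + O(z^{-ρ-σ})` at infinity, for some constant `c`. -/
def HasTwoTermExp (ρ σ a : ℝ) (f : ℝ → ℝ) : Prop :=
  ∃ c : ℝ, (fun z => f z - a - c * z ^ (-ρ)) =O[atTop] fun z : ℝ => z ^ (-ρ - σ)

namespace HasTwoTermExp

variable {ρ σ a b : ℝ} {f g : ℝ → ℝ}

theorem const (a : ℝ) : HasTwoTermExp ρ σ a fun _ => a :=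
  ⟨0, (isBigO_zero _ _).congr_left fun z => by ring⟩

theorem of_isBigO (h : (fun z => f z - a) =O[atTop] fun z : ℝ => z ^ (-ρ - σ)) :
    HasTwoTermExp ρ σ a f :=
  ⟨0, h.congr_left fun z => by ring⟩

theorem congr' (hf : HasTwoTermExp ρ σ a f) (h : f =ᶠ[atTop] g) : HasTwoTermExp ρ σ a g := by
  obtain ⟨c, hc⟩ := hf
  refine ⟨c, hc.congr' ?_ EventuallyEq.rfl⟩
  filter_upwards [h] with z hz
  rw [hz]

theorem add (hf : HasTwoTermExp ρ σ a f) (hg : HasTwoTermExp ρ σ b g) :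
    HasTwoTermExp ρ σ (a + b) fun z => f z + g z := by
  obtain ⟨c, hc⟩ := hf
  obtain ⟨d, hd⟩ := hg
  exact ⟨c + d, (hc.add hd).congr_left fun z => by ring⟩

theorem const_mul (hf : HasTwoTermExp ρ σ a f) (k : ℝ) :
    HasTwoTermExp ρ σ (k * a) fun z => k * f z := by
  obtain ⟨c, hc⟩ := hf
  exact ⟨k * c, (hc.const_mul_left k).congr_left fun z => by ring⟩

theorem isBigO (hf : HasTwoTermExp ρ σ a f) (hσ : 0 < σ) :
    (fun z => f z - a) =O[atTop] fun z : ℝ => z ^ (-ρ) := by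
  obtain ⟨c, hc⟩ := hf
  refine ((hc.trans (isBigO_rpow_rpow_atTop (by linarith))).add
    ((isBigO_refl (fun z : ℝ => z ^ (-ρ)) _).const_mul_left c)).congr_left fun z => by ring

theorem tendsto (hf : HasTwoTermExp ρ σ a f) (hσ : 0 < σ) (hρ : 0 < ρ) :
    Tendsto f atTop (𝓝 a) := by
  have := (tendsto_zero_of_isBigO_rpow (by linarith) (hf.isBigO hσ)).add_const a
  simpa using this

theorem mul (hf : HasTwoTermExp ρ σ a f) (hg : HasTwoTermExp ρ σ b g) (hσ : 0 < σ)
    (hσρ : σ ≤ ρ) : HasTwoTermExp ρ σ (a * b) fun z => f z * g z := by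
  have hfa := hf.isBigO hσ
  have hgb := hg.isBigO hσ
  obtain ⟨c, hc⟩ := hf
  obtain ⟨d, hd⟩ := hg
  refine ⟨a * d + b * c, ?_⟩
  have h1 : (fun z => (f z - a) * (g z - b)) =O[atTop] fun z : ℝ => z ^ (-ρ - σ) :=
    (isBigO_rpow_mul hfa hgb rfl).trans (isBigO_rpow_rpow_atTop (by linarith))
  refine ((h1.add (hd.const_mul_left a)).add (hc.const_mul_left b)).congr_left fun z => by ring

theorem pow (hf : HasTwoTermExp ρ σ a f) (hσ : 0 < σ) (hσρ : σ ≤ ρ) (k : ℕ) :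
    HasTwoTermExp ρ σ (a ^ k) fun z => f z ^ k := by
  induction k with
  | zero => simpa using const (ρ := ρ) (σ := σ) 1
  | succ k ih => simpa only [pow_succ] using ih.mul hf hσ hσρ

end HasTwoTermExp

/-! ### Relations between the constants -/

/-- The positive root `μ` of `μ (μ + 1) = n δ (δ + 1)`: the linearization of `η'' = (2 κ z η) ^ n`
about `λ z ^ (-δ)` has the decaying solution `z ^ (-μ)`. -/
noncomputable def mu (n : ℕ) : ℝ := (Real.sqrt (4 * (n : ℝ) * del n * (del n + 1) + 1) - 1) / 2

/-- The nonlinearity `(2 κ z u + u²) ^ n`. -/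
noncomputable def rate (n : ℕ) (z u : ℝ) : ℝ := (2 * kap * z * u + u ^ 2) ^ n

theorem kap_pos : 0 < kap := by unfold kap; positivity

section Constants

variable {n : ℕ} (hn : 4 ≤ n)

include hn

theorem three_le_sub_one : (3 : ℝ) ≤ n - 1 := by
  have : (4 : ℝ) ≤ n := by exact_mod_cast hn
  linarith

theorem del_mul : del n * ((n : ℝ) - 1) = n + 2 :=
  div_mul_cancel₀ _ (by linarith [three_le_sub_one hn])

theorem one_lt_del : 1 < del n := by
  have h := three_le_sub_one hn
  rw [del, lt_div_iff₀ (by linarith)]; linarith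

theorem del_le_two : del n ≤ 2 := by
  have h := three_le_sub_one hn
  rw [del, div_le_iff₀ (by linarith)]; linarith

theorem mu_mul : mu n * (mu n + 1) = n * (del n * (del n + 1)) := by
  have h := one_lt_del hn
  have h1 : 0 ≤ 4 * (n : ℝ) * del n * (del n + 1) + 1 := by positivity
  have h2 := Real.sq_sqrt h1
  unfold mu
  nlinarith

theorem mu_nonneg : 0 ≤ mu n := by
  have h := one_lt_del hn
  have h1 : Real.sqrt 1 ≤ Real.sqrt (4 * (n : ℝ) * del n * (del n + 1) + 1) :=
    Real.sqrt_le_sqrt (by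
      have : 0 ≤ (n : ℝ) * del n * (del n + 1) := by positivity
      linarith)
  rw [Real.sqrt_one] at h1
  unfold mu
  linarith

theorem lt_mu_of {x : ℝ} (hx : x * (x + 1) < n * (del n * (del n + 1))) : x < mu n := by
  rw [← mu_mul hn] at hx
  have := mu_nonneg hn
  by_contra h
  push Not at h
  nlinarith

theorem mu_lt_of {x : ℝ} (h0 : 0 ≤ x) (hx : n * (del n * (del n + 1)) < x * (x + 1)) :
    mu n < x := by
  rw [← mu_mul hn] at hx
  by_contra h
  push Not at h
  nlinarith

theorem del_add_two_lt_mu : del n + 2 < mu n := by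
  have h1 := del_mul hn
  have h2 := one_lt_del hn
  have h3 := del_le_two hn
  refine lt_mu_of hn ?_
  have h4 : (n : ℝ) * del n = n + 2 + del n := by linarith
  have h5 : (4 : ℝ) ≤ n := by exact_mod_cast hn
  have h6 : (n : ℝ) * (del n * (del n + 1)) = (n + 2 + del n) * (del n + 1) := by
    rw [← h4]; ring
  rw [h6]
  nlinarith

theorem two_mul_del_add_one_lt_mu (h6 : 6 ≤ n) : 2 * del n + 1 < mu n := by
  have h1 := del_mul hn
  have h2 := one_lt_del hn
  have h5 : (6 : ℝ) ≤ n := by exact_mod_cast h6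
  have h4 : (n : ℝ) * del n = n + 2 + del n := by linarith
  have h7 : del n ≤ 8 / 5 := by
    rw [del, div_le_iff₀ (by linarith)]; linarith
  refine lt_mu_of hn ?_
  have h6 : (n : ℝ) * (del n * (del n + 1)) = (n + 2 + del n) * (del n + 1) := by
    rw [← h4]; ring
  rw [h6]
  nlinarith

theorem mu_lt_two_mul_del_add_one (h5 : n ≤ 5) : mu n < 2 * del n + 1 := by
  refine mu_lt_of hn (by linarith [one_lt_del hn]) ?_
  have : n = 4 ∨ n = 5 := by omega
  rcases this with rfl | rfl <;> norm_num [del]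

theorem del_add_two_lt_del' : del n + 2 < del' n := by
  unfold del'
  split_ifs with h
  · exact del_add_two_lt_mu hn
  · linarith [one_lt_del hn]

theorem del'_le_mu : del' n ≤ mu n := by
  unfold del'
  split_ifs with h
  · exact le_rfl
  · exact (two_mul_del_add_one_lt_mu hn (by omega)).le

theorem lam_pos : 0 < lam n := by
  have := one_lt_del hn
  have := kap_pos
  unfold lam
  positivity

theorem lam_pow : (2 * kap * lam n) ^ n = del n * (del n + 1) * lam n := by
  have h1 := one_lt_del hn
  have h2 := kap_pos
  have h3 : lam n ^ (n - 1) = del n * (del n + 1) / (2 * kap) ^ n := by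
    have h4 : ((n - 1 : ℕ) : ℝ) = n - 1 := by rw [Nat.cast_sub (by omega)]; simp
    rw [← Real.rpow_natCast, lam, ← Real.rpow_mul (by positivity), h4,
      div_mul_cancel₀ _ (by linarith [three_le_sub_one hn]), Real.rpow_one]
  obtain ⟨k, rfl⟩ : ∃ k, n = k + 1 := ⟨n - 1, by omega⟩
  rw [Nat.add_sub_cancel] at h3
  rw [mul_pow, pow_succ (lam (k + 1)), h3, ← mul_assoc, mul_div_cancel₀ _ (by positivity)]

theorem lam_pow_sub_one : 2 * kap * (2 * kap * lam n) ^ (n - 1) = del n * (del n + 1) := by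
  have h := lam_pow hn
  obtain ⟨k, rfl⟩ : ∃ k, n = k + 1 := ⟨n - 1, by omega⟩
  rw [pow_succ] at h
  have h1 := (lam_pos hn).ne'
  rw [Nat.add_sub_cancel]
  exact mul_right_cancel₀ h1 (by linear_combination h)

theorem rpow_one_sub_del_pow {z : ℝ} (hz : 0 < z) : (z ^ (1 - del n)) ^ n = z ^ (-del n - 2) := by
  rw [← Real.rpow_natCast, ← Real.rpow_mul hz.le]
  congr 1
  linear_combination -(del_mul hn)

theorem rpow_one_sub_del_pow_sub_one {z : ℝ} (hz : 0 < z) :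
    (z ^ (1 - del n)) ^ (n - 1) * z ^ 3 = 1 := by
  have h4 : ((n - 1 : ℕ) : ℝ) = n - 1 := by rw [Nat.cast_sub (by omega)]; simp
  rw [← Real.rpow_natCast, ← Real.rpow_mul hz.le, h4, ← Real.rpow_natCast z 3, ← Real.rpow_add hz]
  have : (1 - del n) * ((n : ℝ) - 1) + ((3 : ℕ) : ℝ) = 0 := by
    push_cast; linear_combination -(del_mul hn)
  rw [this, Real.rpow_zero]

/-- The constant `λ₀` balances the leading terms of the linear equation. -/
theorem lam0_eq : lam0 n * (mu n * (mu n + 1) - (2 - del n) * (1 - del n)) =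
    lam n * (gam n - alph n * del n) - mu n * (mu n + 1) * kap3 * lam n / kap := by
  have h1 := three_le_sub_one hn
  have h2 := one_lt_del hn
  have h3 := del_mul hn
  have hk := kap_pos.ne'
  have hg : gam n * (del n + 1) = eps n := by
    have h5 : (2 * (n : ℝ) + 1) ≠ 0 := by positivity
    have h6 : ((n : ℝ) - 1) ≠ 0 := by linarith
    rw [gam, eps, del]
    field_simp
    ring
  have hden : ((n : ℝ) - 1) * del n * (del n + 1) + 2 * (2 * del n - 1) ≠ 0 := by
    have : 0 < ((n : ℝ) - 1) * del n * (del n + 1) := by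
      apply mul_pos (mul_pos _ _) <;> linarith
    linarith
  rw [mu_mul hn]
  have hden' : (n : ℝ) * (del n * (del n + 1)) - (2 - del n) * (1 - del n) =
      ((n : ℝ) - 1) * del n * (del n + 1) + 2 * (2 * del n - 1) := by ring
  rw [hden', lam0, mul_assoc, div_mul_cancel₀ _ hden, alph]
  field_simp
  linear_combination (-2 * lam n * kap) * hg

end Constants

/-! ### Existence, uniqueness and two-sided bounds for the nonlinear problem -/

theorem D_eq {f f₁ : ℝ → ℝ} (h : ∀ z, 0 ≤ z → HasDerivAt f (f₁ z) z) {z : ℝ} (hz : 0 ≤ z) :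
    D f z = f₁ z :=
  (h z hz).hasDerivWithinAt.derivWithin (uniqueDiffOn_Ici 0 z hz)

theorem D_D_eq {f f₁ f₂ : ℝ → ℝ} (h : ∀ z, 0 ≤ z → HasDerivAt f (f₁ z) z)
    (h₁ : ∀ z, 0 ≤ z → HasDerivAt f₁ (f₂ z) z) {z : ℝ} (hz : 0 ≤ z) : D (D f) z = f₂ z := by
  rw [← D_eq h₁ hz]
  exact derivWithin_congr (fun y hy => D_eq h hy) (D_eq h hz)

theorem twiceDifferentiable_of_hasDerivAt {f f₁ f₂ : ℝ → ℝ}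
    (h : ∀ z, 0 ≤ z → HasDerivAt f (f₁ z) z) (h₁ : ∀ z, 0 ≤ z → HasDerivAt f₁ (f₂ z) z) :
    TwiceDifferentiable f :=
  ⟨fun z hz => (h z hz).differentiableAt.differentiableWithinAt,
    DifferentiableOn.congr (fun z hz => (h₁ z hz).differentiableAt.differentiableWithinAt)
      fun _ hz => D_eq h hz⟩

theorem TwiceDifferentiable.twiceDerivOn {f : ℝ → ℝ} (h : TwiceDifferentiable f) :
    TwiceDerivOn 0 f (D f) (D (D f)) :=
  ⟨h.1.continuousOn, h.2.continuousOn,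
    fun z hz => (h.1 z hz.le).hasDerivWithinAt.hasDerivAt (Ici_mem_nhds hz),
    fun z hz => (h.2 z hz.le).hasDerivWithinAt.hasDerivAt (Ici_mem_nhds hz)⟩

theorem twiceDerivOn_rpow {a b : ℝ} (hab : 0 < a + b) (p : ℝ) :
    TwiceDerivOn a (fun z => (z + b) ^ p) (fun z => p * (z + b) ^ (p - 1))
      (fun z => p * ((p - 1) * (z + b) ^ (p - 2))) := by
  have h : ∀ (q z : ℝ), a ≤ z → HasDerivAt (fun z => (z + b) ^ q) (q * (z + b) ^ (q - 1)) z := by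
    intro q z hz
    have := ((hasDerivAt_id z).add_const b).rpow_const (p := q)
      (Or.inl (by simp only [id]; linarith))
    simpa using this
  refine TwiceDerivOn.of_hasDerivAt (h p) fun z hz => ?_
  refine ((h (p - 1) z hz).const_mul p).congr_deriv ?_
  ring_nf

theorem rate_mono {n : ℕ} {z x y : ℝ} (hz : 0 ≤ z) (hx : 0 ≤ x) (hxy : x ≤ y) :
    rate n z x ≤ rate n z y := by
  have := kap_pos
  unfold rate
  gcongr

theorem IsEta.twiceDerivOn {n : ℕ} {η : ℝ → ℝ} (h : IsEta n η) :
    TwiceDerivOn 0 η (D η) (fun z => rate n z (η z)) := by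
  have h1 := h.twiceDiff.twiceDerivOn
  refine ⟨h1.cont, h1.cont₁, h1.deriv, fun z hz => ?_⟩
  have := h1.deriv₁ z hz
  rwa [h.ode z hz.le] at this

section

variable {n : ℕ} (hn : 4 ≤ n)

include hn

/-- The exponent `δ` is chosen so that `n (1 - δ) = -δ - 2`. -/
theorem mul_rpow_one_sub_pow {z k : ℝ} (hz : 0 < z) :
    (k * z ^ (1 - del n)) ^ n = k ^ n * z ^ (-del n - 2) := by
  rw [mul_pow, rpow_one_sub_del_pow hn hz]

/-- For large `b` the function `λ (z + b) ^ (-δ)` is a lower solution, hence lies below `η`. Only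
`η ≥ 0` is assumed, so that this also shows positivity of the solution constructed by iteration. -/
theorem exists_lower_bound : ∃ b : ℝ, 0 < b ∧ ∀ η η₁ : ℝ → ℝ,
    TwiceDerivOn 0 η η₁ (fun z => rate n z (η z)) → (∀ z, 0 ≤ z → 0 ≤ η z) → η₁ 0 = -kap →
    Tendsto η atTop (𝓝 0) → ∀ z, 0 ≤ z → lam n * (z + b) ^ (-del n) ≤ η z := by
  have hδ := one_lt_del hn
  have hκ := kap_pos
  have hl := lam_pos hn
  set b := 1 + lam n * del n / kap with hb
  have hb1 : 1 ≤ b := by rw [hb]; have : 0 ≤ lam n * del n / kap := by positivity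
                         linarith
  have hbκ : lam n * del n ≤ kap * b := by
    rw [hb, mul_add, mul_div_cancel₀ _ hκ.ne']; linarith
  refine ⟨b, by linarith, fun η η₁ hη hη0 hη₁ hηlim z hz => ?_⟩
  have hv := ((twiceDerivOn_rpow (a := 0) (b := b) (by linarith) (-del n)).const_mul (lam n))
  have hpow1 : ∀ (p : ℝ), 0 ≤ p → ∀ z, 0 ≤ z → (z + b) ^ (-p) ≤ 1 := fun p hp z hz =>
    Real.rpow_le_one_of_one_le_of_nonpos (by linarith) (by linarith)
  have := (hv.sub hη).nonpos (fun z hz hpos => ?_) (Or.inr ?_) ?_ hz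
  · linarith
  · have hzb : 0 < z + b := by linarith
    set v := lam n * (z + b) ^ (-del n) with hvdef
    have hv0 : 0 < v := mul_pos hl (Real.rpow_pos_of_pos hzb _)
    have h1 : rate n z (η z) ≤ rate n z v := rate_mono hz.le (hη0 z hz.le) (by linarith)
    have hvl : v ≤ 2 * kap * b := by
      have := mul_le_mul_of_nonneg_left (hpow1 (del n) (by linarith) z hz.le) hl.le
      nlinarith
    have h2 : rate n z v ≤ (2 * kap * lam n * (z + b) ^ (1 - del n)) ^ n := by
      have e : (z + b) ^ (1 - del n) = (z + b) ^ (-del n) * (z + b) := by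
        rw [← Real.rpow_add_one hzb.ne']; ring_nf
      have e2 : 2 * kap * lam n * (z + b) ^ (1 - del n) = 2 * kap * (z + b) * v := by
        rw [e, hvdef]; ring
      rw [e2, rate]
      have : 2 * kap * z * v + v ^ 2 ≤ 2 * kap * (z + b) * v := by nlinarith
      gcongr
    rw [mul_rpow_one_sub_pow hn hzb, lam_pow hn] at h2
    have e : lam n * (-del n * ((-del n - 1) * (z + b) ^ (-del n - 2))) =
      del n * (del n + 1) * lam n * (z + b) ^ (-del n - 2) := by ring
    rw [e]
    linarith
  · rw [hη₁]
    have h1 := hpow1 (del n + 1) (by linarith) 0 le_rfl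
    have e : -(del n + 1) = -del n - 1 := by ring
    have h2 : (0 + b) ^ (-del n - 1) * b ≤ 1 := by
      rw [zero_add, ← Real.rpow_add_one (by linarith)]
      have := hpow1 (del n) (by linarith) 0 le_rfl
      rw [zero_add] at this
      ring_nf at this ⊢
      exact this
    have h3 : 0 < (0 + b) ^ (-del n - 1) := Real.rpow_pos_of_pos (by linarith) _
    have h4 := mul_le_mul_of_nonneg_right hbκ h3.le
    have h5 := mul_le_mul_of_nonneg_left h2 hκ.le
    linarith
  · have h1 : Tendsto (fun z : ℝ => (z + b) ^ (-del n)) atTop (𝓝 0) :=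
      (tendsto_rpow_neg_atTop (by linarith)).comp (tendsto_atTop_add_const_right _ b tendsto_id)
    simpa using (h1.const_mul (lam n)).sub hηlim

/-- The singular solution `λ z ^ (-δ)` of `η'' = (2 κ z η) ^ n` lies above `η`. -/
theorem IsEta.le_rpow {η : ℝ → ℝ} (hη : IsEta n η) {z : ℝ} (hz : 0 < z) :
    η z ≤ lam n * z ^ (-del n) := by
  have hδ := one_lt_del hn
  have hκ := kap_pos
  have hl := lam_pos hn
  -- near `0` the comparison is trivial because the singular solution is unbounded there
  obtain ⟨a, ha0, haz, ha⟩ : ∃ a, 0 < a ∧ a ≤ z ∧ η a ≤ lam n * a ^ (-del n) := by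
    have h1 : Tendsto (fun z : ℝ => lam n * z ^ (-del n)) (𝓝[>] 0) atTop :=
      (tendsto_rpow_neg_nhdsGT_zero (by linarith)).const_mul_atTop hl
    have h2 : Tendsto η (𝓝[>] 0) (𝓝 (η 0)) :=
      (hη.twiceDerivOn.cont 0 self_mem_Ici).tendsto.mono_left
        (nhdsWithin_mono _ Ioi_subset_Ici_self)
    have h3 := h2.eventually (gt_mem_nhds (lt_add_one (η 0)))
    obtain ⟨a, ⟨⟨ha1, ha2⟩, ha3⟩⟩ :=
      ((h3.and (h1.eventually_ge_atTop (η 0 + 1))).and (Ioc_mem_nhdsGT hz)).exists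
    exact ⟨a, ha3.1, ha3.2, by linarith⟩
  have hv := ((twiceDerivOn_rpow (a := a) (b := 0) (by linarith) (-del n)).const_mul (lam n))
  simp only [add_zero] at hv
  have := ((hη.twiceDerivOn.mono ha0.le).sub hv).nonpos (fun x hx hpos => ?_)
    (Or.inl (by simpa using ha)) ?_ haz
  · linarith
  · have hx0 : 0 < x := ha0.trans hx
    have hx1 := Real.rpow_pos_of_pos hx0 (-del n)
    have h1 : (2 * kap * lam n * x ^ (1 - del n)) ^ n ≤ rate n x (η x) := by
      have e : x ^ (1 - del n) = x ^ (-del n) * x := by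
        rw [← Real.rpow_add_one hx0.ne']; ring_nf
      rw [rate, e]
      have h2 : 2 * kap * lam n * (x ^ (-del n) * x) ≤ 2 * kap * x * η x + η x ^ 2 := by
        have : lam n * x ^ (-del n) ≤ η x := by linarith
        have h3 : 2 * kap * x * (lam n * x ^ (-del n)) ≤ 2 * kap * x * η x := by gcongr
        nlinarith [sq_nonneg (η x)]
      gcongr
    rw [mul_rpow_one_sub_pow hn hx0, lam_pow hn] at h1
    linarith
  · simpa using hη.tendsto.sub ((tendsto_rpow_neg_atTop (by linarith : 0 < del n)).const_mul (lam n))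

/-- The nonlinear problem is solved between `0` and `A (z + 1) ^ (-δ)` with a large `A`; positivity
follows from the lower bound afterwards. -/
theorem exists_isEta : ∃ η : ℝ → ℝ, IsEta n η := by
  have hδ := one_lt_del hn
  have hδ2 := del_le_two hn
  have hκ := kap_pos
  set δ := del n with hδdef
  have hn4 : (4 : ℝ) ≤ n := by exact_mod_cast hn
  -- the amplitude of the upper solution `A (z + 1) ^ (-δ)`
  obtain ⟨A, hA1, hA2, hA3⟩ : ∃ A : ℝ, 4 * kap ≤ A ∧ 1 ≤ A * kap ∧ 6 ≤ A * kap * kap := by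
    refine ⟨4 * kap + 1 / kap + 6 / kap ^ 2, ?_, ?_, ?_⟩
    · have : 0 < 1 / kap + 6 / kap ^ 2 := by positivity
      linarith
    · have e : (4 * kap + 1 / kap + 6 / kap ^ 2) * kap = 4 * kap ^ 2 + 1 + 6 / kap := by field_simp
      have : 0 < 4 * kap ^ 2 + 6 / kap := by positivity
      linarith
    · have e : (4 * kap + 1 / kap + 6 / kap ^ 2) * kap * kap = 4 * kap ^ 3 + kap + 6 := by
        field_simp
      have : 0 < 4 * kap ^ 3 + kap := by positivity
      linarith
  have hA0 : 0 < A := by linarith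
  set M := 2 * kap * A + A ^ 2 with hM
  have hM0 : 0 < M := by positivity
  have hV := (twiceDerivOn_rpow (a := 0) (b := 1) (by norm_num) (-δ)).const_mul A
  have hpow : ∀ z : ℝ, 0 ≤ z → (z + 1) ^ (1 - δ) = (z + 1) ^ (-δ) * (z + 1) := fun z hz => by
    rw [← Real.rpow_add_one (by linarith)]; ring_nf
  have hpow0 : ∀ (p z : ℝ), 0 ≤ z → 0 < (z + 1) ^ p := fun p z hz =>
    Real.rpow_pos_of_pos (by linarith) _
  have hpow1 : ∀ (p z : ℝ), p ≤ 0 → 0 ≤ z → (z + 1) ^ p ≤ 1 := fun p z hp hz =>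
    Real.rpow_le_one_of_one_le_of_nonpos (by linarith) hp
  have hP : ∀ z, 0 ≤ z → ∀ x, 0 ≤ x → x ≤ A * (z + 1) ^ (-δ) →
      2 * kap * z * x + x ^ 2 ≤ M * (z + 1) ^ (1 - δ) := by
    intro z hz x hx hxA
    have h1 := hpow0 (-δ) z hz
    have h2 := hpow1 (-δ) z (by linarith) hz
    have hxA' : x ≤ A := hxA.trans (mul_le_of_le_one_right hA0.le h2)
    rw [hpow z hz, hM]
    calc 2 * kap * z * x + x ^ 2 = (2 * kap * z + x) * x := by ring
      _ ≤ ((2 * kap + A) * (z + 1)) * (A * (z + 1) ^ (-δ)) := by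
          refine mul_le_mul ?_ hxA hx (by positivity)
          nlinarith [mul_nonneg hA0.le hz]
      _ = _ := by ring
  set W := (2 * kap + 2 * A) * n * M ^ (n - 1) with hW
  have hW0 : 0 < W := by positivity
  have hLip : ∀ z, 0 ≤ z → ∀ x y, 0 ≤ x → x ≤ y → y ≤ A * (z + 1) ^ (-δ) →
      rate n z y - rate n z x ≤ W * (y - x) := by
    intro z hz x y hx hxy hy
    have hy0 := hx.trans hxy
    have h2 := hpow1 (-δ) z (by linarith) hz
    have hyA : y ≤ A := hy.trans (mul_le_of_le_one_right hA0.le h2)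
    have hPx : 0 ≤ 2 * kap * z * x + x ^ 2 := by positivity
    have hPy : 0 ≤ 2 * kap * z * y + y ^ 2 := by positivity
    have hPxy : 2 * kap * z * x + x ^ 2 ≤ 2 * kap * z * y + y ^ 2 := by gcongr
    have h3 := (le_abs_self _).trans
      (abs_pow_sub_pow_le (2 * kap * z * y + y ^ 2) (2 * kap * z * x + x ^ 2) n)
    rw [abs_of_nonneg hPx, abs_of_nonneg hPy, max_eq_left hPxy,
      abs_of_nonneg (by linarith)] at h3
    have h4 : (2 * kap * z * y + y ^ 2) ^ (n - 1) ≤ M ^ (n - 1) * ((z + 1) ^ (1 - δ)) ^ (n - 1) := by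
      rw [← mul_pow]
      exact pow_le_pow_left₀ hPy (hP z hz y hy0 hy) _
    have h5 : ((z + 1) ^ (1 - δ)) ^ (n - 1) * (z + 1) ≤ 1 := by
      have h6 := rpow_one_sub_del_pow_sub_one hn (by linarith : 0 < z + 1)
      refine le_of_le_of_eq ?_ h6
      refine mul_le_mul_of_nonneg_left ?_ (pow_nonneg (hpow0 _ z hz).le _)
      nlinarith [mul_nonneg hz hz, mul_nonneg (mul_nonneg hz hz) hz]
    have h7 : 2 * kap * z * y + y ^ 2 - (2 * kap * z * x + x ^ 2) ≤
        (y - x) * ((2 * kap + 2 * A) * (z + 1)) := by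
      have : 2 * kap * z + y + x ≤ (2 * kap + 2 * A) * (z + 1) := by
        nlinarith [mul_nonneg hA0.le hz]
      calc _ = (y - x) * (2 * kap * z + y + x) := by ring
        _ ≤ _ := mul_le_mul_of_nonneg_left this (by linarith)
    calc _ ≤ _ := h3
      _ ≤ (y - x) * ((2 * kap + 2 * A) * (z + 1)) * n *
          (M ^ (n - 1) * ((z + 1) ^ (1 - δ)) ^ (n - 1)) := by
          have : 0 ≤ y - x := by linarith
          gcongr
      _ = W * (y - x) * (((z + 1) ^ (1 - δ)) ^ (n - 1) * (z + 1)) := by rw [hW]; ring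
      _ ≤ W * (y - x) * 1 := mul_le_mul_of_nonneg_left h5 (mul_nonneg hW0.le (by linarith))
      _ = _ := mul_one _
  obtain ⟨η, η₁, h1, h2, h3, h4⟩ := exists_solution_between (G := rate n) (ω := Real.sqrt W)
    (b := -kap) (C := M ^ n + 2 * A) (v := fun _ => 0) (v₁ := fun _ => 0) (v₂ := fun _ => 0)
    (by unfold rate Function.uncurry; fun_prop) (Real.sqrt_pos.2 hW0)
    (TwiceDerivOn.of_hasDerivAt (fun z _ => hasDerivAt_const z 0) fun z _ => hasDerivAt_const z 0)
    hV (fun z hz => (mul_pos hA0 (hpow0 _ z hz)).le)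
    (fun z _ => by simp [rate, show n ≠ 0 by omega])
    (fun z hz => by
      have hz1 := hpow0 (-δ) z hz.le
      have h5 : A * kap * (z + 1) ^ (1 - δ) ≤ 2 * kap * z * (A * (z + 1) ^ (-δ)) +
          (A * (z + 1) ^ (-δ)) ^ 2 := by
        have h6 : kap * (z + 1) ≤ 2 * kap * z + A * (z + 1) ^ (-δ) := by
          rcases le_or_gt 1 z with h | h
          · have : 0 < A * (z + 1) ^ (-δ) := by positivity
            nlinarith
          · have h7 : (1 : ℝ) / 4 ≤ (z + 1) ^ (-δ) := by
              calc (1 : ℝ) / 4 = 2 ^ (-2 : ℝ) := by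
                    rw [Real.rpow_neg (by norm_num)]; norm_num
                _ ≤ 2 ^ (-δ) := Real.rpow_le_rpow_of_exponent_le (by norm_num) (by linarith)
                _ ≤ _ := Real.rpow_le_rpow_of_nonpos (by linarith) (by linarith) (by linarith)
            nlinarith [mul_nonneg hκ.le hz.le]
        rw [hpow z hz.le]
        calc _ = (kap * (z + 1)) * (A * (z + 1) ^ (-δ)) := by ring
          _ ≤ (2 * kap * z + A * (z + 1) ^ (-δ)) * (A * (z + 1) ^ (-δ)) := by gcongr
          _ = _ := by ring
      have h6 : (A * kap * (z + 1) ^ (1 - δ)) ^ n ≤ rate n z (A * (z + 1) ^ (-δ)) := by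
        have := hpow0 (1 - δ) z hz.le
        unfold rate; gcongr
      rw [mul_rpow_one_sub_pow hn (by linarith)] at h6
      refine le_trans ?_ h6
      have h7 : A * (δ * (δ + 1)) ≤ (A * kap) ^ n := by
        have e : (A * kap) ^ 2 ≤ (A * kap) ^ n := pow_le_pow_right₀ hA2 (by omega)
        have : δ * (δ + 1) ≤ 6 := by nlinarith
        nlinarith
      have h8 := mul_le_mul_of_nonneg_right h7 (hpow0 (-δ - 2) z hz.le).le
      calc _ = A * (δ * (δ + 1)) * (z + 1) ^ (-δ - 2) := by ring
        _ ≤ _ := h8)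
    (by linarith)
    (by simp only [zero_add, Real.one_rpow]; nlinarith)
    (fun z hz x y hx hxy hy => by rw [Real.sq_sqrt hW0.le]; exact hLip z hz x y hx hxy hy)
    (fun z hz x hx hxA => by
      have h5 := hP z hz x hx hxA
      have h6 : 0 ≤ 2 * kap * z * x + x ^ 2 := by positivity
      have h7 := mul_le_of_le_one_right hM0.le (hpow1 (1 - δ) z (by linarith) hz)
      rw [abs_of_nonneg (by unfold rate; positivity)]
      have h8 : rate n z x ≤ M ^ n := pow_le_pow_left₀ h6 (h5.trans h7) n
      linarith)
    (fun z _ => by simp only [abs_zero]; positivity)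
    (fun z _ => by simp only [abs_zero]; positivity)
    (fun z hz => by
      have h5 := hpow0 (-δ) z hz
      rw [abs_of_nonneg (by positivity)]
      have h6 := mul_le_of_le_one_right hA0.le (hpow1 (-δ) z (by linarith) hz)
      have : 0 < M ^ n := by positivity
      linarith)
    (fun z hz => by
      have h5 := hpow0 (-δ - 1) z hz
      have h6 := mul_le_of_le_one_right hA0.le (hpow1 (-δ - 1) z (by linarith) hz)
      have : 0 < M ^ n := by positivity
      rw [abs_of_nonpos (by nlinarith [mul_pos hA0 h5])]
      nlinarith [mul_pos hA0 h5])
  have hD1 : ∀ z, 0 ≤ z → D η z = η₁ z := fun z hz => D_eq h1 hz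
  have hTD := TwiceDerivOn.of_hasDerivAt h1 h2
  have hlim : Tendsto η atTop (𝓝 0) := by
    have h5 : Tendsto (fun z : ℝ => A * (z + 1) ^ (-δ)) atTop (𝓝 0) := by
      have h6 : Tendsto (fun z : ℝ => (z + 1) ^ (-δ)) atTop (𝓝 0) :=
        (tendsto_rpow_neg_atTop (by linarith)).comp (tendsto_atTop_add_const_right _ 1 tendsto_id)
      simpa using h6.const_mul A
    refine squeeze_zero' ?_ ?_ h5
    · filter_upwards [eventually_ge_atTop 0] with z hz using (h4 z hz).1
    · filter_upwards [eventually_ge_atTop 0] with z hz using (h4 z hz).2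
  obtain ⟨b, hb, hlow⟩ := exists_lower_bound hn
  exact ⟨η, twiceDifferentiable_of_hasDerivAt h1 h2,
    fun z hz => (mul_pos (lam_pos hn) (Real.rpow_pos_of_pos (by linarith) _)).trans_le
      (hlow η η₁ hTD (fun z hz => (h4 z hz).1) h3 hlim z hz),
    fun z hz => D_D_eq h1 h2 hz, (hD1 0 le_rfl).trans h3, hlim⟩

theorem IsEta.exists_lower_bound {η : ℝ → ℝ} (hη : IsEta n η) :
    ∃ b : ℝ, 0 < b ∧ ∀ z, 0 ≤ z → lam n * (z + b) ^ (-del n) ≤ η z := by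
  obtain ⟨b, hb, h⟩ := ReactionFront.exists_lower_bound hn
  exact ⟨b, hb, h η (D η) hη.twiceDerivOn (fun z hz => (hη.pos z hz).le) hη.deriv_zero hη.tendsto⟩

end

/-! ### Expansion of the nonlinear solution at infinity -/

theorem abs_add_rpow_sub_rpow_le {a b z : ℝ} (ha : a ≤ 1) (hb : 0 ≤ b) (hz : 0 < z) :
    |(z + b) ^ a - z ^ a| ≤ |a| * z ^ (a - 1) * b := by
  have h := (convex_Ici z).norm_image_sub_le_of_norm_hasDerivWithin_le
    (f := fun x : ℝ => x ^ a) (f' := fun x => a * x ^ (a - 1)) (C := |a| * z ^ (a - 1))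
    (fun x hx => (Real.hasDerivAt_rpow_const
      (Or.inl (hz.trans_le hx).ne')).hasDerivWithinAt)
    (fun x hx => by
      rw [Real.norm_eq_abs, abs_mul, abs_of_pos (Real.rpow_pos_of_pos (hz.trans_le hx) _)]
      exact mul_le_mul_of_nonneg_left
        (Real.rpow_le_rpow_of_nonpos hz hx (by linarith)) (abs_nonneg a))
    self_mem_Ici (mem_Ici.2 (by linarith : z ≤ z + b))
  simpa [abs_of_nonneg hb] using h

theorem isBigO_one_add_pow_sub {t : ℝ → ℝ} {q : ℝ} (hq : 0 ≤ q)
    (ht : t =O[atTop] fun z : ℝ => z ^ (-q)) (k : ℕ) :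
    (fun z => (1 + t z) ^ k - 1 - k * t z) =O[atTop] fun z : ℝ => z ^ (-(2 * q)) := by
  have h1 : (fun z => 1 + t z) =O[atTop] fun z : ℝ => z ^ (0 : ℝ) :=
    (isBigO_const_rpow le_rfl 1).add (ht.trans (isBigO_rpow_rpow_atTop (by linarith)))
  have h2 := isBigO_rpow_mul ht ht (by ring : -q + -q = -(2 * q))
  induction k with
  | zero => exact (isBigO_zero _ _).congr_left fun z => by simp
  | succ k ih =>
    refine ((isBigO_rpow_mul h1 ih (zero_add _)).add (h2.const_mul_left (k : ℝ))).congr_left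
      fun z => ?_
    push_cast
    ring

theorem isBigO_div_of_sub {n : ℕ} {η : ℝ → ℝ} {q : ℝ}
    (hq : (fun z => η z - lam n * z ^ (-del n)) =O[atTop] fun z : ℝ => z ^ (-(del n + q))) :
    (fun z => η z / (2 * kap * z) - lam n / (2 * kap) * z ^ (-(del n + 1))) =O[atTop]
      fun z : ℝ => z ^ (-(del n + q + 1)) := by
  have hκ := kap_pos
  refine ((isBigO_rpow_mul hq (isBigO_refl (fun z : ℝ => z ^ (-1 : ℝ)) _)
    (by ring : -(del n + q) + -1 = -(del n + q + 1))).const_mul_left (1 / (2 * kap))).congr' ?_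
      EventuallyEq.rfl
  filter_upwards [eventually_gt_atTop 0] with z hz
  have e : z ^ (-(del n + 1)) = z ^ (-del n) * z ^ (-1 : ℝ) := by
    rw [← Real.rpow_add hz]; ring_nf
  rw [e, Real.rpow_neg_one]
  field_simp

section

variable {n : ℕ} (hn : 4 ≤ n) {η : ℝ → ℝ}

include hn

/-- The factorization of the nonlinearity: with `η = λ z ^ (-δ) (1 + s)` it equals
the `n`-th power of `2 κ λ z ^ (1 - δ) (1 + s) (1 + η / (2 κ z))`. -/
theorem base_eq {z : ℝ} (hz : 0 < z) :
    2 * kap * z * η z + η z ^ 2 = 2 * kap * lam n * z ^ (1 - del n) *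
      (η z * z ^ del n / lam n * (1 + η z / (2 * kap * z))) := by
  have hκ := kap_pos
  have hl := lam_pos hn
  have e : z ^ (1 - del n) * z ^ del n = z := by rw [← Real.rpow_add hz]; simp
  field_simp
  linear_combination (-η z * (2 * z * kap + η z)) * e

theorem isBigO_mul_of_sub {q : ℝ}
    (hq : (fun z => η z - lam n * z ^ (-del n)) =O[atTop] fun z : ℝ => z ^ (-(del n + q))) :
    (fun z => η z * z ^ del n / lam n - 1) =O[atTop] fun z : ℝ => z ^ (-q) := by
  have hl := lam_pos hn
  refine ((isBigO_rpow_mul hq (isBigO_refl (fun z : ℝ => z ^ del n) _)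
    (by ring : -(del n + q) + del n = -q)).const_mul_left (1 / lam n)).congr' ?_
      EventuallyEq.rfl
  filter_upwards [eventually_gt_atTop 0] with z hz
  have e : z ^ (-del n) * z ^ del n = 1 := by rw [← Real.rpow_add hz]; simp
  field_simp
  linear_combination (-lam n) * e

/-- The equation for the remainder `r = η - λ z ^ (-δ)` is a forced Euler equation, up to terms
quadratic in `r`. -/
theorem isBigO_euler_error {q : ℝ} (hq0 : 0 ≤ q) (hqδ : q ≤ del n + 1)
    (hq : (fun z => η z - lam n * z ^ (-del n)) =O[atTop] fun z : ℝ => z ^ (-(del n + q))) :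
    (fun z => z ^ 2 * (rate n z (η z) - lam n * (del n * (del n + 1)) * z ^ (-del n - 2)) -
      mu n * (mu n + 1) * (η z - lam n * z ^ (-del n)) -
      lam n * (mu n * (mu n + 1)) * (lam n / (2 * kap)) * z ^ (-(2 * del n + 1))) =O[atTop]
      fun z : ℝ => z ^ (-(del n + min (2 * q) (del n + 1 + q))) := by
  have hδ := one_lt_del hn
  set S : ℝ → ℝ := fun z => η z * z ^ del n / lam n - 1 with hS
  set X : ℝ → ℝ := fun z => η z / (2 * kap * z) with hX
  have hSO : S =O[atTop] fun z : ℝ => z ^ (-q) := isBigO_mul_of_sub hn hq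
  have hX' := isBigO_div_of_sub hq
  have hXO : X =O[atTop] fun z : ℝ => z ^ (-(del n + 1)) :=
    ((hX'.trans (isBigO_rpow_rpow_atTop (by linarith))).add
      ((isBigO_refl (fun z : ℝ => z ^ (-(del n + 1))) _).const_mul_left
        (lam n / (2 * kap)))).congr_left fun z => by simp only [hX]; ring
  have hSX := isBigO_rpow_mul hSO hXO (by ring : -q + -(del n + 1) = -(del n + 1 + q))
  have ht : (fun z => S z + X z + S z * X z) =O[atTop] fun z : ℝ => z ^ (-q) :=
    (hSO.add (hXO.trans (isBigO_rpow_rpow_atTop (by linarith)))).add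
      (hSX.trans (isBigO_rpow_rpow_atTop (by linarith)))
  have hquad := isBigO_one_add_pow_sub hq0 ht n
  have h1 : (fun z => (1 + (S z + X z + S z * X z)) ^ n - 1 - n * (S z + X z + S z * X z)) =O[atTop]
      fun z : ℝ => z ^ (-min (2 * q) (del n + 1 + q)) :=
    hquad.trans (isBigO_rpow_rpow_atTop (neg_le_neg (min_le_left _ _)))
  have h2 : (fun z => (n : ℝ) * (X z - lam n / (2 * kap) * z ^ (-(del n + 1)))) =O[atTop]
      fun z : ℝ => z ^ (-min (2 * q) (del n + 1 + q)) :=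
    (hX'.trans (isBigO_rpow_rpow_atTop
      (by linarith [min_le_right (2 * q) (del n + 1 + q)]))).const_mul_left _
  have h3 : (fun z => (n : ℝ) * (S z * X z)) =O[atTop]
      fun z : ℝ => z ^ (-min (2 * q) (del n + 1 + q)) :=
    (hSX.trans (isBigO_rpow_rpow_atTop (neg_le_neg (min_le_right _ _)))).const_mul_left _
  refine ((isBigO_rpow_mul (isBigO_refl (fun z : ℝ => z ^ (-del n)) _) ((h1.add h2).add h3)
    (by ring : -del n + -min (2 * q) (del n + 1 + q) =
      -(del n + min (2 * q) (del n + 1 + q)))).const_mul_left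
      (lam n * (del n * (del n + 1)))).congr' ?_ EventuallyEq.rfl
  filter_upwards [eventually_gt_atTop 0] with z hz
  have hl := lam_pos hn
  have hw : η z * z ^ del n / lam n * (1 + η z / (2 * kap * z)) =
      1 + (S z + X z + S z * X z) := by simp only [hS, hX]; ring
  have e1 : z ^ (-del n - 2) * z ^ 2 = z ^ (-del n) := by
    rw [← Real.rpow_natCast z 2, ← Real.rpow_add hz]; norm_num
  have e2 : z ^ (-del n) * z ^ (-(del n + 1)) = z ^ (-(2 * del n + 1)) := by
    rw [← Real.rpow_add hz]; ring_nf
  have hrate : z ^ 2 * rate n z (η z) =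
      del n * (del n + 1) * lam n * z ^ (-del n) * (1 + (S z + X z + S z * X z)) ^ n := by
    rw [rate, base_eq hn hz, hw, mul_pow, mul_rpow_one_sub_pow hn hz, lam_pow hn, ← e1]
    ring
  have hr : η z - lam n * z ^ (-del n) = lam n * z ^ (-del n) * S z := by
    have e : z ^ (-del n) * z ^ del n = 1 := by rw [← Real.rpow_add hz]; simp
    simp only [hS]
    field_simp
    linear_combination (-η z) * e
  rw [hr, mu_mul hn]
  linear_combination -hrate + lam n * (del n * (del n + 1)) * e1 -
    lam n * (n * (del n * (del n + 1))) * (lam n / (2 * kap)) * e2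

variable (hη : IsEta n η)

include hη

theorem IsEta.sub_isBigO :
    (fun z => η z - lam n * z ^ (-del n)) =O[atTop] fun z : ℝ => z ^ (-(del n + 1)) := by
  obtain ⟨b, hb, hlow⟩ := hη.exists_lower_bound hn
  have hδ := one_lt_del hn
  have hl := lam_pos hn
  refine IsBigO.of_bound (lam n * (|-del n| * b)) ?_
  filter_upwards [eventually_gt_atTop 0] with z hz
  have h1 := abs_add_rpow_sub_rpow_le (a := -del n) (by linarith) hb.le hz
  have h2 := hη.le_rpow hn hz
  have h3 := hlow z hz.le
  have e : -(del n + 1) = -del n - 1 := by ring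
  rw [Real.norm_eq_abs, Real.norm_of_nonneg (Real.rpow_nonneg hz.le _), abs_of_nonpos (by linarith),
    e]
  have h4 := mul_le_mul_of_nonneg_left ((neg_abs_le _).trans' (neg_le_neg h1)) hl.le
  linarith

/-- The two-term expansion of `η`, which may be differentiated once. For `n ≤ 5` the second term
comes from the decaying solution `z ^ (-μ)` of the linearization, for `n ≥ 6` from the term `η²` of
the nonlinearity; in both cases the other one is absorbed by the error. -/
theorem IsEta.exists_expansion : ∃ σ C : ℝ, 0 < σ ∧ σ ≤ 1 ∧
    (del' n + σ ≤ 2 * del n + 1 ∨ del' n = 2 * del n + 1) ∧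
    ((fun z => η z - lam n * z ^ (-del n) - C * z ^ (-del' n)) =O[atTop]
      fun z : ℝ => z ^ (-(del' n + σ))) ∧
    (fun z => z * (D η z - lam n * (-del n * z ^ (-del n - 1))) +
      del' n * (C * z ^ (-del' n))) =O[atTop] fun z : ℝ => z ^ (-(del' n + σ)) := by
  have hδ := one_lt_del hn
  have hδ2 := del_le_two hn
  have hμ := del_add_two_lt_mu hn
  have hr : ∀ᶠ z in atTop, HasDerivAt (fun z => η z - lam n * z ^ (-del n))
      (D η z - lam n * (-del n * z ^ (-del n - 1))) z := by
    filter_upwards [eventually_gt_atTop 0] with z hz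
    exact (hη.twiceDerivOn.deriv z hz).sub
      ((Real.hasDerivAt_rpow_const (Or.inl hz.ne')).const_mul _)
  have hr₁ : ∀ᶠ z in atTop, HasDerivAt (fun z => D η z - lam n * (-del n * z ^ (-del n - 1)))
      (rate n z (η z) - lam n * (del n * (del n + 1)) * z ^ (-del n - 2)) z := by
    filter_upwards [eventually_gt_atTop 0] with z hz
    refine ((hη.twiceDerivOn.deriv₁ z hz).sub (((Real.hasDerivAt_rpow_const
      (Or.inl hz.ne')).const_mul (-del n)).const_mul (lam n))).congr_deriv ?_
    have e : -del n - 1 - 1 = -del n - 2 := by ring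
    rw [e]; ring
  have hlim : Tendsto (fun z => η z - lam n * z ^ (-del n)) atTop (𝓝 0) := by
    simpa using hη.tendsto.sub
      ((tendsto_rpow_neg_atTop (by linarith : 0 < del n)).const_mul (lam n))
  have hc := (isBigO_refl (fun z : ℝ => z ^ (-(2 * del n + 1))) atTop).const_mul_left
    (lam n * (mu n * (mu n + 1)) * (lam n / (2 * kap)))
  -- one application of the Euler lemma improves the error from `δ + 1` to `δ + 2`
  have h2 := (euler_asymptotics_of_lt (p := del n + 2) (by linarith) hμ (by linarith) hr hr₁ hlim
    ((((isBigO_euler_error hn zero_le_one (by linarith) (hη.sub_isBigO hn)).trans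
      (isBigO_rpow_rpow_atTop (by
        have := le_min (by norm_num : (2 : ℝ) ≤ 2 * 1) (by linarith : 2 ≤ del n + 1 + 1)
        linarith))).add
      (hc.trans (isBigO_rpow_rpow_atTop (by linarith)))).congr_left fun z => by ring)).1
  have h3 := (isBigO_euler_error hn zero_le_two (by linarith) h2).trans
    (isBigO_rpow_rpow_atTop (q := -(2 * del n + 2)) (by
        have := le_min (by linarith : del n + 2 ≤ 2 * 2) (by linarith : del n + 2 ≤ del n + 1 + 2)
        linarith))
  rcases le_or_gt n 5 with h5 | h5
  · have hd : del' n = mu n := by rw [del', if_pos h5, mu]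
    have hlt := mu_lt_two_mul_del_add_one hn h5
    obtain ⟨C, hC1, hC2⟩ := euler_asymptotics (p := 2 * del n + 1) (by linarith) hlt.ne'
      (by linarith) hr hr₁ hlim
      (((h3.trans (isBigO_rpow_rpow_atTop (by linarith))).add hc).congr_left fun z => by ring)
    have e : mu n + (2 * del n + 1 - mu n) = 2 * del n + 1 := by ring
    rw [hd]
    exact ⟨2 * del n + 1 - mu n, C, by linarith, by linarith, Or.inl e.le, by rwa [e], by rwa [e]⟩
  · have hd : del' n = 2 * del n + 1 := by rw [del', if_neg (by omega)]
    have hlt := two_mul_del_add_one_lt_mu hn (by omega)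
    set σ := min 1 ((mu n - (2 * del n + 1)) / 2) with hσ
    have hσ0 : 0 < σ := lt_min one_pos (by linarith)
    have hσ1 : σ ≤ 1 := min_le_left _ _
    have hσ2 : σ ≤ (mu n - (2 * del n + 1)) / 2 := min_le_right _ _
    obtain ⟨C, hC1, hC2⟩ := euler_asymptotics_forced (p := 2 * del n + 1) (q := 2 * del n + 1 + σ)
      (by linarith) (by linarith) (by linarith) hr hr₁ hlim
      (h3.trans (isBigO_rpow_rpow_atTop (by linarith)))
    rw [hd]
    exact ⟨σ, C, hσ0, hσ1, Or.inr rfl, hC1, hC2⟩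

/-- The coefficient functions of the linear problem are built from three functions with two-term
expansions in the powers `1`, `z ^ (δ - δ')`. -/
theorem IsEta.exists_hasTwoTermExp : ∃ σ : ℝ, 0 < σ ∧ σ ≤ 1 ∧
    HasTwoTermExp (del' n - del n) σ 1 (fun z => η z * z ^ del n / lam n) ∧
    HasTwoTermExp (del' n - del n) σ 0 (fun z => η z / (2 * kap * z)) ∧
    HasTwoTermExp (del' n - del n) σ (-(lam n * del n)) (fun z => z ^ (del n + 1) * D η z) := by
  have hδ := one_lt_del hn
  have hδ' := del_add_two_lt_del' hn
  have hl := lam_pos hn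
  obtain ⟨σ, C, hσ0, hσ1, hor, h1, h2⟩ := hη.exists_expansion hn
  refine ⟨σ, hσ0, hσ1, ⟨C / lam n, ?_⟩, ?_, ⟨-(del' n * C), ?_⟩⟩
  · refine ((isBigO_rpow_mul h1 (isBigO_refl (fun z : ℝ => z ^ del n) _)
      (by ring : -(del' n + σ) + del n = -(del' n - del n) - σ)).const_mul_left
      (1 / lam n)).congr' ?_ EventuallyEq.rfl
    filter_upwards [eventually_gt_atTop 0] with z hz
    have e : z ^ (-del n) * z ^ del n = 1 := by rw [← Real.rpow_add hz]; simp
    have e1 : z ^ (-del' n) * z ^ del n = z ^ (-(del' n - del n)) := by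
      rw [← Real.rpow_add hz]; ring_nf
    field_simp
    linear_combination (-lam n) * e - C * e1
  · have hsub : (fun z => η z - lam n * z ^ (-del n)) =O[atTop] fun z : ℝ => z ^ (-(del n + 2)) :=
      ((h1.trans (isBigO_rpow_rpow_atTop (by linarith))).add
        (((isBigO_refl (fun z : ℝ => z ^ (-del' n)) _).const_mul_left C).trans
          (isBigO_rpow_rpow_atTop (by linarith)))).congr_left fun z => by ring
    have hX := isBigO_div_of_sub hsub
    rcases hor with h | h
    · refine HasTwoTermExp.of_isBigO ?_
      refine ((hX.trans (isBigO_rpow_rpow_atTop (by linarith))).add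
        (((isBigO_refl (fun z : ℝ => z ^ (-(del n + 1))) _).const_mul_left
          (lam n / (2 * kap))).trans (isBigO_rpow_rpow_atTop (by linarith)))).congr_left
        fun z => by ring
    · refine ⟨lam n / (2 * kap), (hX.trans (isBigO_rpow_rpow_atTop (by linarith))).congr_left
        fun z => ?_⟩
      have e : -(del' n - del n) = -(del n + 1) := by rw [h]; ring
      rw [e]; ring
  · refine (isBigO_rpow_mul h2 (isBigO_refl (fun z : ℝ => z ^ del n) _)
      (by ring : -(del' n + σ) + del n = -(del' n - del n) - σ)).congr' ?_ EventuallyEq.rfl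
    filter_upwards [eventually_gt_atTop 0] with z hz
    have e : z ^ (-del n - 1) * (z * z ^ del n) = 1 := by
      rw [mul_comm z, ← Real.rpow_add_one hz.ne', ← Real.rpow_add hz]
      ring_nf; simp
    have e1 : z ^ (-del' n) * z ^ del n = z ^ (-(del' n - del n)) := by
      rw [← Real.rpow_add hz]; ring_nf
    have e2 : z ^ (del n + 1) = z * z ^ del n := by
      rw [mul_comm, ← Real.rpow_add_one hz.ne']
    rw [e2]
    linear_combination (lam n * del n) * e + del' n * C * e1

end

/-! ### The linear problem -/

/-- The coefficient `q` of the linear equation in the form `h'' = q h + g`. -/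
noncomputable def linCoef (n : ℕ) (η : ℝ → ℝ) (z : ℝ) : ℝ :=
  (n : ℝ) * (2 * kap * z * η z + η z ^ 2) ^ (n - 1) * (2 * kap * z + 2 * η z)

/-- The inhomogeneity `g` of the linear equation in the form `h'' = q h + g`. -/
noncomputable def linSource (n : ℕ) (η : ℝ → ℝ) (z : ℝ) : ℝ :=
  (n : ℝ) * (2 * kap * z * η z + η z ^ 2) ^ (n - 1) * (2 * kap3 * z ^ 3 * η z) -
    gam n * η z - alph n * z * D η z

theorem exists_forall_abs_le_of_isBigO {f : ℝ → ℝ} {p : ℝ} (hf : ContinuousOn f (Ici 0))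
    (hO : f =O[atTop] fun z : ℝ => z ^ (-p)) (hp : 0 ≤ p) :
    ∃ K : ℝ, 0 ≤ K ∧ ∀ z, 0 ≤ z → |f z| ≤ K * (z + 1) ^ (-p) := by
  obtain ⟨K, hK⟩ := hO.bound
  obtain ⟨A, hA⟩ := eventually_atTop.1 (hK.and (eventually_ge_atTop 1))
  have hc : ContinuousOn (fun z => f z * (z + 1) ^ p) (Icc 0 A) :=
    (hf.mono Icc_subset_Ici_self).mul (ContinuousOn.rpow_const (by fun_prop)
      fun z hz => Or.inr hp)
  obtain ⟨B, hB⟩ := isCompact_Icc.exists_bound_of_continuousOn hc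
  refine ⟨max (|K| * 2 ^ p) |B|, by positivity, fun z hz => ?_⟩
  have hz1 : 0 < z + 1 := by linarith
  have hpos := Real.rpow_pos_of_pos hz1 p
  have hkey : |f z| * (z + 1) ^ p ≤ max (|K| * 2 ^ p) |B| := by
    rcases le_or_gt z A with h | h
    · have := hB z ⟨hz, h⟩
      rw [Real.norm_eq_abs, abs_mul, abs_of_pos hpos] at this
      exact this.trans ((le_abs_self B).trans (le_max_right _ _))
    · obtain ⟨h1, h2⟩ := hA z h.le
      have hz0 : 0 < z := by linarith
      have hzp := Real.rpow_pos_of_pos hz0 p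
      rw [Real.norm_eq_abs, Real.norm_of_nonneg (Real.rpow_nonneg hz _)] at h1
      have h3 : (z + 1) ^ p ≤ 2 ^ p * z ^ p := by
        rw [← Real.mul_rpow (by norm_num) hz]
        exact Real.rpow_le_rpow hz1.le (by linarith) hp
      have e : z ^ (-p) * z ^ p = 1 := by rw [← Real.rpow_add hz0]; simp
      refine le_trans ?_ (le_max_left _ _)
      calc |f z| * (z + 1) ^ p ≤ (|K| * z ^ (-p)) * (2 ^ p * z ^ p) := by
            refine mul_le_mul (h1.trans ?_) h3 hpos.le (by positivity)
            exact mul_le_mul_of_nonneg_right (le_abs_self K) (Real.rpow_nonneg hz _)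
        _ = |K| * 2 ^ p := by linear_combination |K| * 2 ^ p * e
  rw [Real.rpow_neg hz1.le, ← div_eq_mul_inv, le_div_iff₀ hpos]
  exact hkey

theorem exists_forall_le_of_tendsto {f : ℝ → ℝ} {L : ℝ} (hf : ContinuousOn f (Ici 0))
    (hpos : ∀ z, 0 ≤ z → 0 < f z) (hL : 0 < L) (hlim : Tendsto f atTop (𝓝 L)) :
    ∃ c : ℝ, 0 < c ∧ ∀ z, 0 ≤ z → c ≤ f z := by
  obtain ⟨A, hA⟩ := eventually_atTop.1
    ((hlim.eventually (lt_mem_nhds (half_lt_self hL))).and (eventually_ge_atTop 0))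
  obtain ⟨x, hx, hmin⟩ := isCompact_Icc.exists_isMinOn (nonempty_Icc.2 (hA A le_rfl).2)
    (hf.mono Icc_subset_Ici_self)
  refine ⟨min (f x) (L / 2), lt_min (hpos x hx.1) (by linarith), fun z hz => ?_⟩
  rcases le_or_gt z A with h | h
  · exact (min_le_left _ _).trans (hmin ⟨hz, h⟩)
  · exact (min_le_right _ _).trans (hA z h.le).1.le

/-- Second-order Taylor expansion at the endpoint, in Peano's form. -/
theorem expansionAtZero_of_deriv_zero {h : ℝ → ℝ} (hd : TwiceDifferentiable h)
    (h0 : D h 0 = 0) : ExpansionAtZero h ![h 0, D (D h) 0 / 2] ![0, 2] := by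
  refine ⟨by rw [Fin.strictMono_iff_lt_succ]; simp, ?_⟩
  have hTD := hd.twiceDerivOn
  have hslope : Tendsto (fun x => D h x / x) (𝓝[>] 0) (𝓝 (D (D h) 0)) := by
    have h1 := (hd.2 0 self_mem_Ici).hasDerivWithinAt
    rw [hasDerivWithinAt_iff_tendsto_slope] at h1
    have e : Ici (0 : ℝ) \ {0} = Ioi 0 := by
      ext x; simp [lt_iff_le_and_ne, eq_comm]
    rw [e] at h1
    refine h1.congr fun x => ?_
    rw [slope_def_field, h0, sub_zero, sub_zero]
  have hlim := HasDerivAt.lhopital_zero_nhdsGT (a := 0)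
    (f := fun x => h x - h 0 - D (D h) 0 / 2 * x ^ 2) (f' := fun x => D h x - D (D h) 0 * x)
    (g := fun x => x ^ 2) (g' := fun x => 2 * x) (l := 𝓝 0)
    (by
      filter_upwards [self_mem_nhdsWithin] with x hx
      refine (((hTD.deriv x hx).sub_const _).sub
        ((hasDerivAt_pow 2 x).const_mul (D (D h) 0 / 2))).congr_deriv ?_
      norm_num; ring)
    (by
      filter_upwards with x
      simpa using hasDerivAt_pow 2 x)
    (by
      filter_upwards [self_mem_nhdsWithin] with x hx
      exact mul_ne_zero two_ne_zero (ne_of_gt hx))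
    (by
      have h1 : Tendsto h (𝓝[>] 0) (𝓝 (h 0)) := (hTD.cont 0 self_mem_Ici).tendsto.mono_left
        (nhdsWithin_mono _ Ioi_subset_Ici_self)
      have h2 : Tendsto (fun x : ℝ => D (D h) 0 / 2 * x ^ 2) (𝓝[>] 0) (𝓝 0) := by
        have : Continuous fun x : ℝ => D (D h) 0 / 2 * x ^ 2 := by fun_prop
        simpa using (this.tendsto 0).mono_left nhdsWithin_le_nhds
      simpa using (h1.sub_const (h 0)).sub h2)
    (by
      have : Continuous fun x : ℝ => x ^ 2 := by fun_prop
      simpa using (this.tendsto 0).mono_left nhdsWithin_le_nhds)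
    (by
      have h1 := (hslope.sub_const (D (D h) 0)).div_const 2
      rw [sub_self, zero_div] at h1
      refine h1.congr' ?_
      filter_upwards [self_mem_nhdsWithin] with x hx
      have : x ≠ 0 := ne_of_gt hx
      field_simp)
  have hlim' := hlim.abs
  rw [abs_zero] at hlim'
  refine hlim'.congr' ?_
  filter_upwards [self_mem_nhdsWithin] with x hx
  have hx0 : (0 : ℝ) < x := hx
  simp [Fin.sum_univ_two, Fin.last, abs_div]
  rw [div_eq_inv_mul, sub_sub]

section

variable {n : ℕ} (hn : 4 ≤ n) {η : ℝ → ℝ}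

include hn

theorem linCoef_mul_sq {z : ℝ} (hz : 0 < z) :
    z ^ 2 * linCoef n η z = mu n * (mu n + 1) *
      ((η z * z ^ del n / lam n * (1 + 1 * (η z / (2 * kap * z)))) ^ (n - 1) *
        (1 + 2 * (η z / (2 * kap * z)))) := by
  have hκ := kap_pos
  have h1 := rpow_one_sub_del_pow_sub_one hn hz
  have h2 := lam_pow_sub_one hn
  rw [linCoef, base_eq hn hz, mul_pow, mul_pow _ (z ^ (1 - del n)), mu_mul hn, ← h2, one_mul]
  have e : 2 * kap * z + 2 * η z = 2 * kap * z * (1 + 2 * (η z / (2 * kap * z))) := by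
    field_simp
  rw [e]
  linear_combination (n * (2 * kap * (2 * kap * lam n) ^ (n - 1)) *
    ((η z * z ^ del n / lam n * (1 + η z / (2 * kap * z))) ^ (n - 1) *
        (1 + 2 * (η z / (2 * kap * z))))) * h1

theorem linSource_mul_rpow {z : ℝ} (hz : 0 < z) :
    z ^ del n * linSource n η z = mu n * (mu n + 1) * kap3 * lam n / kap *
      ((η z * z ^ del n / lam n * (1 + 1 * (η z / (2 * kap * z)))) ^ (n - 1) *
        (η z * z ^ del n / lam n)) + -(gam n * lam n) * (η z * z ^ del n / lam n) +
        -alph n * (z ^ (del n + 1) * D η z) := by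
  have hκ := kap_pos
  have hl := lam_pos hn
  have h1 := rpow_one_sub_del_pow_sub_one hn hz
  have h2 := lam_pow_sub_one hn
  have e2 : z ^ (del n + 1) = z ^ del n * z := Real.rpow_add_one hz.ne' _
  rw [linSource, base_eq hn hz, mul_pow, mul_pow _ (z ^ (1 - del n)), mu_mul hn, ← h2, one_mul, e2]
  set w := (η z * z ^ del n / lam n * (1 + η z / (2 * kap * z))) ^ (n - 1)
  set Z := (z ^ (1 - del n)) ^ (n - 1)
  set l := (2 * kap * lam n) ^ (n - 1)
  field_simp
  linear_combination (n * l * w * 2 * kap3 * η z) * h1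

variable (hη : IsEta n η)

include hη

theorem IsEta.linCoef_pos {z : ℝ} (hz : 0 ≤ z) : 0 < linCoef n η z := by
  have h1 := hη.pos z hz
  have h2 := kap_pos
  have h3 : (0 : ℝ) < n := by exact_mod_cast (by omega : 0 < n)
  unfold linCoef
  positivity

/-- Two-term expansions of the coefficients of the linear equation. The second one vanishes to
leading order exactly for the value `λ₀`. -/
theorem IsEta.exists_hasTwoTermExp_lin : ∃ σ : ℝ, 0 < σ ∧ σ ≤ 1 ∧
    HasTwoTermExp (del' n - del n) σ (mu n * (mu n + 1)) (fun z => z ^ 2 * linCoef n η z) ∧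
    HasTwoTermExp (del' n - del n) σ 0 (fun z => z ^ del n * linSource n η z +
      (lam0 n * (z ^ 2 * linCoef n η z) + -(lam0 n * ((2 - del n) * (1 - del n))))) := by
  obtain ⟨σ, hσ0, hσ1, hS, hX, hY⟩ := hη.exists_hasTwoTermExp hn
  have hδ' := del_add_two_lt_del' hn
  have hσρ : σ ≤ del' n - del n := by linarith
  have hW := (hS.mul ((HasTwoTermExp.const 1).add (hX.const_mul 1)) hσ0 hσρ).pow hσ0 hσρ (n - 1)
  have hQ : HasTwoTermExp (del' n - del n) σ (mu n * (mu n + 1))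
      (fun z => z ^ 2 * linCoef n η z) := by
    have := (hW.mul ((HasTwoTermExp.const 1).add (hX.const_mul 2)) hσ0 hσρ).const_mul
      (mu n * (mu n + 1))
    simp only [mul_zero, add_zero, mul_one, one_pow] at this
    refine this.congr' ?_
    filter_upwards [eventually_gt_atTop 0] with z hz
    rw [linCoef_mul_sq hn hz]
  refine ⟨σ, hσ0, hσ1, hQ, ?_⟩
  have hG := (((hW.mul hS hσ0 hσρ).const_mul (mu n * (mu n + 1) * kap3 * lam n / kap)).add
    (hS.const_mul (-(gam n * lam n)))).add (hY.const_mul (-alph n))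
  have hF := hG.add ((hQ.const_mul (lam0 n)).add
    (HasTwoTermExp.const (-(lam0 n * ((2 - del n) * (1 - del n))))))
  have e : mu n * (mu n + 1) * kap3 * lam n / kap * ((1 * (1 + 1 * 0)) ^ (n - 1) * 1) +
      -(gam n * lam n) * 1 + -alph n * -(lam n * del n) + (lam0 n * (mu n * (mu n + 1)) +
      -(lam0 n * ((2 - del n) * (1 - del n)))) = 0 := by
    have e1 : ((1 : ℝ) * (1 + 1 * 0)) ^ (n - 1) = 1 := by simp
    rw [e1]
    linear_combination lam0_eq hn
  rw [e] at hF
  refine hF.congr' ?_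
  filter_upwards [eventually_gt_atTop 0] with z hz
  rw [linSource_mul_rpow hn hz]

omit hn in
theorem IsEta.continuousOn_linCoef : ContinuousOn (linCoef n η) (Ici 0) := by
  have := hη.twiceDerivOn.cont
  unfold linCoef
  fun_prop

omit hn in
theorem IsEta.continuousOn_linSource : ContinuousOn (linSource n η) (Ici 0) := by
  have := hη.twiceDerivOn.cont
  have := hη.twiceDerivOn.cont₁
  unfold linSource
  fun_prop

omit hn hη in
theorem IsH.twiceDerivOn {h : ℝ → ℝ} (hh : IsH n η h) :
    TwiceDerivOn 0 h (D h) (fun z => linCoef n η z * h z + linSource n η z) := by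
  have h1 := hh.twiceDiff.twiceDerivOn
  refine ⟨h1.cont, h1.cont₁, h1.deriv, fun z hz => ?_⟩
  refine (h1.deriv₁ z hz).congr_deriv ?_
  have := hh.ode z hz.le
  unfold linCoef linSource
  linear_combination this

theorem IsH.eqOn {h g : ℝ → ℝ} (hh : IsH n η h) (hg : IsH n η g) : EqOn g h (Ici 0) := by
  intro z hz
  refine sub_eq_zero.1 ((hg.twiceDerivOn.sub hh.twiceDerivOn).eq_zero ?_ ?_ ?_ ?_ hz)
  · intro z hz hpos
    have := mul_nonneg (hη.linCoef_pos hn hz.le).le hpos.le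
    linarith
  · intro z hz hneg
    have := mul_nonneg (hη.linCoef_pos hn hz.le).le (neg_nonneg.2 hneg.le)
    linarith
  · simp only [hg.deriv_zero, hh.deriv_zero, sub_self]
  · have := hg.tendsto.sub hh.tendsto
    rw [sub_self] at this
    refine this.congr fun z => ?_
    simp only [phi2]; ring

/-- The function `φ₂` solves an Euler equation with right-hand side `O(z ^ (2 - δ'))`. -/
theorem IsH.exists_expansionAtTop {h : ℝ → ℝ} (hh : IsH n η h) :
    ∃ lam' : ℝ, ExpansionAtTop h ![lam0 n, lam'] ![del n - 2, del' n - 2] := by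
  obtain ⟨σ, hσ0, hσ1, hQ, hF⟩ := hη.exists_hasTwoTermExp_lin hn
  have hδ := one_lt_del hn
  have hδ2 := del_le_two hn
  have hδ' := del_add_two_lt_del' hn
  have hδμ := del'_le_mu hn
  have hTD := hh.twiceDerivOn
  have hk : ∀ᶠ z in atTop, HasDerivAt (phi2 n h)
      (-lam0 n * ((2 - del n) * z ^ (2 - del n - 1)) + D h z) z := by
    filter_upwards [eventually_gt_atTop 0] with z hz
    exact ((Real.hasDerivAt_rpow_const (Or.inl hz.ne')).const_mul _).add (hTD.deriv z hz)
  have hk₁ : ∀ᶠ z in atTop, HasDerivAt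
      (fun z => -lam0 n * ((2 - del n) * z ^ (2 - del n - 1)) + D h z)
      (-lam0 n * ((2 - del n) * ((1 - del n) * z ^ (-del n))) +
        (linCoef n η z * h z + linSource n η z)) z := by
    filter_upwards [eventually_gt_atTop 0] with z hz
    refine ((((Real.hasDerivAt_rpow_const (Or.inl hz.ne')).const_mul _).const_mul _).add
      (hTD.deriv₁ z hz)).congr_deriv ?_
    have e : 2 - del n - 1 - 1 = -del n := by ring
    rw [e]; ring
  have herr : ∀ᶠ z : ℝ in atTop, z ^ 2 * (-lam0 n * ((2 - del n) * ((1 - del n) * z ^ (-del n))) +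
        (linCoef n η z * h z + linSource n η z)) - mu n * (mu n + 1) * phi2 n h z =
      (z ^ 2 * linCoef n η z - mu n * (mu n + 1)) * phi2 n h z + z ^ (2 - del n) *
        (z ^ del n * linSource n η z +
          (lam0 n * (z ^ 2 * linCoef n η z) + -(lam0 n * ((2 - del n) * (1 - del n))))) := by
    filter_upwards [eventually_gt_atTop 0] with z hz
    have e1 : z ^ (2 - del n) = z ^ 2 * z ^ (-del n) := by
      rw [← Real.rpow_natCast z 2, ← Real.rpow_add hz]; norm_num; ring_nf
    have e2 : z ^ (-del n) * z ^ del n = 1 := by rw [← Real.rpow_add hz]; simp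
    rw [phi2, e1]
    linear_combination (-z ^ 2 * linSource n η z) * e2
  have hQO := hQ.isBigO hσ0
  -- a first application of the Euler lemma gives the size of the remainder
  have hFO := isBigO_rpow_mul (isBigO_refl (fun z : ℝ => z ^ (2 - del n)) _) (hF.isBigO hσ0)
    (by ring : 2 - del n + -(del' n - del n) = -(del' n - 2))
  simp only [sub_zero] at hFO
  have hbdd : phi2 n h =O[atTop] fun z : ℝ => z ^ (0 : ℝ) := by
    simpa using hh.tendsto.isBigO_one ℝ
  have h1 := (euler_asymptotics_of_lt (m := mu n) (p := del' n - 2) (by linarith) (by linarith)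
    (by linarith) hk hk₁ hh.tendsto
    ((((isBigO_rpow_mul hQO hbdd (add_zero _)).trans
      (isBigO_rpow_rpow_atTop (by linarith))).add hFO).congr'
        (herr.mono fun z hz => hz.symm) EventuallyEq.rfl)).1
  -- a second one isolates its leading term
  obtain ⟨c, hc⟩ := hF
  have hFc := isBigO_rpow_mul (isBigO_refl (fun z : ℝ => z ^ (2 - del n)) _) hc
    (by ring : 2 - del n + (-(del' n - del n) - σ) = -(del' n - 2 + σ))
  obtain ⟨C, hC, -⟩ := euler_asymptotics_forced (m := mu n) (p := del' n - 2)
    (q := del' n - 2 + σ) (c := c) (by linarith) (by linarith) (by linarith) hk hk₁ hh.tendsto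
    ((((isBigO_rpow_mul hQO h1 rfl).trans
      (isBigO_rpow_rpow_atTop (by linarith))).add hFc).congr' (by
        filter_upwards [herr, eventually_gt_atTop 0] with z hz hz0
        rw [hz]
        have e : z ^ (2 - del n) * z ^ (-(del' n - del n)) = z ^ (-(del' n - 2)) := by
          rw [← Real.rpow_add hz0]; ring_nf
        linear_combination (-c) * e) EventuallyEq.rfl)
  refine ⟨C, ?_, ?_⟩
  · rw [Fin.strictMono_iff_lt_succ]
    simp; linarith
  · have h2 := (tendsto_zero_of_isBigO_rpow (by linarith : -σ < 0)
      (isBigO_rpow_mul (isBigO_refl (fun z : ℝ => z ^ (del' n - 2)) _) hC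
        (by ring : del' n - 2 + -(del' n - 2 + σ) = -σ))).abs
    rw [abs_zero] at h2
    refine h2.congr' ?_
    filter_upwards [eventually_gt_atTop 0] with z hz
    have hzp := Real.rpow_pos_of_pos hz (del' n - 2)
    have e : -(del n - 2) = 2 - del n := by ring
    have e1 : h z - (lam0 n * z ^ (-(del n - 2)) + C * z ^ (-(del' n - 2))) =
      phi2 n h z - C * z ^ (-(del' n - 2)) := by rw [e, phi2]; ring
    rw [abs_mul, abs_of_pos hzp, ← e1]
    change _ = z ^ (del' n - 2) * |h z - ∑ i : Fin 2, ![lam0 n, C] i *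
      z ^ (-(![del n - 2, del' n - 2] i))|
    rw [Fin.sum_univ_two]
    rfl

/-- The linear problem is solved for `k = h - λ₀ (z + 1) ^ (2 - δ)`, which is bounded, between the
barriers `± B (z + 1) ^ (-s)`. -/
theorem IsEta.exists_isH : ∃ h : ℝ → ℝ, IsH n η h := by
  obtain ⟨σ, hσ0, hσ1, hQ, hF⟩ := hη.exists_hasTwoTermExp_lin hn
  have hδ := one_lt_del hn
  have hδ2 := del_le_two hn
  have hδ' := del_add_two_lt_del' hn
  have hμ := del_add_two_lt_mu hn
  have hQO := hQ.isBigO hσ0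
  have hFO := hF.isBigO hσ0
  have hqc := hη.continuousOn_linCoef
  have hqpos := fun z (hz : 0 ≤ z) => hη.linCoef_pos hn hz
  have hpc : ∀ p : ℝ, ContinuousOn (fun z : ℝ => (z + 1) ^ p) (Ici 0) := fun p =>
    ContinuousOn.rpow_const (by fun_prop) fun z hz => Or.inl (by
      have : (0 : ℝ) ≤ z := hz
      linarith)
  have hpow0 : ∀ (p z : ℝ), 0 ≤ z → 0 < (z + 1) ^ p := fun p z hz =>
    Real.rpow_pos_of_pos (by linarith) _
  have hpow1 : ∀ (p z : ℝ), p ≤ 0 → 0 ≤ z → (z + 1) ^ p ≤ 1 := fun p z hp hz =>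
    Real.rpow_le_one_of_one_le_of_nonpos (by linarith) hp
  have hshift : ∀ a : ℝ, a ≤ 1 → (fun z : ℝ => (z + 1) ^ a - z ^ a) =O[atTop]
      fun z : ℝ => z ^ (a - 1) := fun a ha => by
    refine IsBigO.of_bound |a| ?_
    filter_upwards [eventually_gt_atTop 0] with z hz
    rw [Real.norm_eq_abs, Real.norm_of_nonneg (Real.rpow_nonneg hz.le _)]
    simpa using abs_add_rpow_sub_rpow_le ha zero_le_one hz
  -- the equation for `k = h - λ₀ (z + 1) ^ (2 - δ)` is `k'' = q k + f` with `f` small at infinity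
  set f : ℝ → ℝ := fun z => linSource n η z + lam0 n * (linCoef n η z * (z + 1) ^ (2 - del n) -
    (2 - del n) * ((1 - del n) * (z + 1) ^ (-del n))) with hfdef
  have hfc : ContinuousOn f (Ici 0) := by
    have h1 := hpc (2 - del n)
    have h2 := hpc (-del n)
    have h3 := hη.continuousOn_linSource
    fun_prop
  have hq2 : linCoef n η =O[atTop] fun z : ℝ => z ^ (-2 : ℝ) := by
    have h1 : (fun z => z ^ 2 * linCoef n η z) =O[atTop] fun z : ℝ => z ^ (0 : ℝ) :=
      ((hQO.trans (isBigO_rpow_rpow_atTop (by linarith))).add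
        (isBigO_const_rpow le_rfl (mu n * (mu n + 1)))).congr_left fun z => by ring
    refine (isBigO_rpow_mul (isBigO_refl (fun z : ℝ => z ^ (-2 : ℝ)) _) h1 (add_zero _)).congr'
      ?_ EventuallyEq.rfl
    filter_upwards [eventually_gt_atTop 0] with z hz
    have e : z ^ (-2 : ℝ) * z ^ 2 = 1 := by
      rw [← Real.rpow_natCast z 2, ← Real.rpow_add hz]; norm_num
    rw [← mul_assoc, e, one_mul]
  have hfO : f =O[atTop] fun z : ℝ => z ^ (-(del n + 1)) := by
    have h1 := isBigO_rpow_mul (isBigO_refl (fun z : ℝ => z ^ (-del n)) _) hFO rfl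
    have h2 := (isBigO_rpow_mul hq2 (hshift (2 - del n) (by linarith))
      (by ring : -2 + (2 - del n - 1) = -(del n + 1))).const_mul_left (lam0 n)
    have h3 := (hshift (-del n) (by linarith)).const_mul_left
      (lam0 n * ((2 - del n) * (1 - del n)))
    have e3 : -del n - 1 = -(del n + 1) := by ring
    rw [e3] at h3
    refine (((h1.trans (isBigO_rpow_rpow_atTop (by linarith))).add h2).sub h3).congr' ?_
      EventuallyEq.rfl
    filter_upwards [eventually_gt_atTop 0] with z hz
    have e1 : z ^ (2 - del n) = z ^ 2 * z ^ (-del n) := by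
      rw [← Real.rpow_natCast z 2, ← Real.rpow_add hz]; norm_num; ring_nf
    have e2 : z ^ (-del n) * z ^ del n = 1 := by rw [← Real.rpow_add hz]; simp
    simp only [hfdef]
    rw [e1]
    linear_combination linSource n η z * e2
  obtain ⟨K, hK0, hK⟩ := exists_forall_abs_le_of_isBigO hfc hfO (by linarith)
  obtain ⟨Ω, hΩ0, hΩ⟩ := exists_forall_abs_le_of_isBigO hqc hq2 (by norm_num)
  obtain ⟨c, hc0, hc⟩ : ∃ c : ℝ, 0 < c ∧ ∀ z, 0 ≤ z → c ≤ (z + 1) ^ 2 * linCoef n η z := by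
    have hμ0 : 0 < mu n := by linarith
    refine exists_forall_le_of_tendsto (L := mu n * (mu n + 1)) (by fun_prop)
      (fun z hz => mul_pos (by positivity) (hqpos z hz)) (by positivity) ?_
    have h1 := hQ.tendsto hσ0 (by linarith)
    have h2 : Tendsto (fun z : ℝ => (1 + z⁻¹) ^ 2) atTop (𝓝 1) := by
      simpa using (tendsto_inv_atTop_zero.const_add (1 : ℝ)).pow 2
    have h3 := h2.mul h1
    rw [one_mul] at h3
    refine h3.congr' ?_
    filter_upwards [eventually_gt_atTop 0] with z hz
    field_simp
  -- the exponent `s` and the amplitude `B` of the barriers `± B (z + 1) ^ (-s)`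
  obtain ⟨s, hs0, hs1, hs2, hs3⟩ : ∃ s : ℝ, 0 < s ∧ s ≤ 1 ∧ s ≤ del n - 1 ∧ s ≤ c / 4 :=
    ⟨min (min 1 (del n - 1)) (c / 4), lt_min (lt_min one_pos (by linarith)) (by linarith),
      (min_le_left _ _).trans (min_le_left _ _), (min_le_left _ _).trans (min_le_right _ _),
      min_le_right _ _⟩
  set b := -(lam0 n * (2 - del n)) with hbdef
  obtain ⟨B, hB1, hB2⟩ : ∃ B : ℝ, K ≤ B * (c / 2) ∧ |b| ≤ B * s := by
    refine ⟨K / (c / 2) + |b| / s, ?_, ?_⟩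
    · rw [add_mul, div_mul_cancel₀ _ (by positivity)]
      have : 0 ≤ |b| / s * (c / 2) := by positivity
      linarith
    · rw [add_mul, div_mul_cancel₀ _ hs0.ne']
      have : 0 ≤ K / (c / 2) * s := by positivity
      linarith
  have hB0 : 0 ≤ B := nonneg_of_mul_nonneg_left (hK0.trans hB1) (by positivity)
  have hbase := twiceDerivOn_rpow (a := 0) (b := 1) (by norm_num) (-s)
  have hbarrier : ∀ z, 0 ≤ z → B * (-s * ((-s - 1) * (z + 1) ^ (-s - 2))) + |f z| ≤
      linCoef n η z * (B * (z + 1) ^ (-s)) := by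
    intro z hz
    have hz1 : 0 < z + 1 := by linarith
    have h1 : |f z| ≤ K * (z + 1) ^ (-s - 2) := (hK z hz).trans
      (mul_le_mul_of_nonneg_left
        (Real.rpow_le_rpow_of_exponent_le (by linarith) (by linarith)) hK0)
    have h2 : c * (z + 1) ^ (-s - 2) ≤ linCoef n η z * (z + 1) ^ (-s) := by
      have e : (z + 1) ^ (-s) = (z + 1) ^ (-s - 2) * (z + 1) ^ 2 := by
        rw [← Real.rpow_natCast (z + 1) 2, ← Real.rpow_add hz1]; norm_num
      rw [e]
      have := mul_le_mul_of_nonneg_right (hc z hz) (hpow0 (-s - 2) z hz).le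
      linarith
    have h3 : s * (s + 1) ≤ c / 2 := by nlinarith
    have h4 := hpow0 (-s - 2) z hz
    have h5 : B * (s * (s + 1)) + K ≤ B * c := by nlinarith
    have h6 := mul_le_mul_of_nonneg_right h5 h4.le
    have h7 := mul_le_mul_of_nonneg_left h2 hB0
    linarith
  have hq1 : ∀ z, 0 ≤ z → linCoef n η z ≤ Ω := fun z hz =>
    ((le_abs_self _).trans (hΩ z hz)).trans
      (mul_le_of_le_one_right hΩ0 (hpow1 _ z (by norm_num) hz))
  have hf1 : ∀ z, 0 ≤ z → |f z| ≤ K := fun z hz =>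
    (hK z hz).trans (mul_le_of_le_one_right hK0 (hpow1 _ z (by linarith) hz))
  have hb1 : ∀ z, 0 ≤ z → |B * (z + 1) ^ (-s)| ≤ B := fun z hz => by
    have := hpow0 (-s) z hz
    rw [abs_of_nonneg (by positivity)]
    exact mul_le_of_le_one_right hB0 (hpow1 _ z (by linarith) hz)
  have hb2 : ∀ z, 0 ≤ z → |B * (-s * (z + 1) ^ (-s - 1))| ≤ B := fun z hz => by
    have h1 := hpow0 (-s - 1) z hz
    rw [abs_mul, abs_of_nonneg hB0, abs_mul, abs_neg, abs_of_pos hs0, abs_of_pos h1]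
    refine mul_le_of_le_one_right hB0 ?_
    have := hpow1 (-s - 1) z (by linarith) hz
    nlinarith
  have hC1 : B ≤ Ω * B + K + B := by nlinarith [mul_nonneg hΩ0 hB0]
  obtain ⟨k, k₁, hk, hk₁, hk0, hkb⟩ := exists_solution_between
    (G := fun z u => linCoef n η z * u + f z) (ω := Real.sqrt (Ω + 1)) (b := b)
    (C := Ω * B + K + B)
    (by
      have h1 : ContinuousOn (fun p : ℝ × ℝ => linCoef n η p.1) (Ici 0 ×ˢ univ) :=
        hqc.comp continuousOn_fst fun p hp => hp.1
      have h2 : ContinuousOn (fun p : ℝ × ℝ => f p.1) (Ici 0 ×ˢ univ) :=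
        hfc.comp continuousOn_fst fun p hp => hp.1
      exact (h1.mul continuousOn_snd).add h2)
    (Real.sqrt_pos.2 (by linarith)) (hbase.const_mul (-B)) (hbase.const_mul B)
    (fun z hz => by
      have := mul_nonneg hB0 (hpow0 (-s) z hz).le
      linarith)
    (fun z hz => by
      have := hbarrier z hz.le
      have := le_abs_self (f z)
      linarith)
    (fun z hz => by
      have := hbarrier z hz.le
      have := neg_abs_le (f z)
      linarith)
    (by
      simp only [zero_add, Real.one_rpow]
      linarith [le_abs_self b])
    (by
      simp only [zero_add, Real.one_rpow]
      linarith [neg_abs_le b])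
    (fun z hz x y _ hxy _ => by
      rw [Real.sq_sqrt (by linarith)]
      have := mul_le_mul_of_nonneg_right (hq1 z hz) (sub_nonneg.2 hxy)
      linarith)
    (fun z hz x hx1 hx2 => by
      have hx : |x| ≤ B := abs_le.2
        ⟨by linarith [(abs_le.1 (hb1 z hz)).2], hx2.trans (abs_le.1 (hb1 z hz)).2⟩
      refine (abs_add_le _ _).trans ?_
      rw [abs_mul, abs_of_pos (hqpos z hz)]
      have := mul_le_mul (hq1 z hz) hx (abs_nonneg _) hΩ0
      linarith [hf1 z hz])
    (fun z hz => by rw [neg_mul, abs_neg]; exact (hb1 z hz).trans hC1)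
    (fun z hz => by rw [neg_mul, abs_neg]; exact (hb2 z hz).trans hC1)
    (fun z hz => (hb1 z hz).trans hC1)
    (fun z hz => (hb2 z hz).trans hC1)
  have hpd : ∀ (p z : ℝ), 0 ≤ z →
      HasDerivAt (fun z => (z + 1) ^ p) (p * (z + 1) ^ (p - 1)) z := by
    intro p z hz
    have := ((hasDerivAt_id z).add_const 1).rpow_const (p := p)
      (Or.inl (by simp only [id]; linarith))
    simpa using this
  have hh : ∀ z, 0 ≤ z → HasDerivAt (fun z => k z + lam0 n * (z + 1) ^ (2 - del n))
      (k₁ z + lam0 n * ((2 - del n) * (z + 1) ^ (2 - del n - 1))) z := fun z hz =>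
    (hk z hz).add ((hpd _ z hz).const_mul _)
  have hh₁ : ∀ z, 0 ≤ z → HasDerivAt
      (fun z => k₁ z + lam0 n * ((2 - del n) * (z + 1) ^ (2 - del n - 1)))
      (linCoef n η z * (k z + lam0 n * (z + 1) ^ (2 - del n)) + linSource n η z) z := by
    intro z hz
    refine ((hk₁ z hz).add (((hpd _ z hz).const_mul _).const_mul _)).congr_deriv ?_
    have e : 2 - del n - 1 - 1 = -del n := by ring
    rw [e]
    simp only [hfdef]
    ring
  refine ⟨_, twiceDifferentiable_of_hasDerivAt hh hh₁, fun z hz => ?_, ?_, ?_⟩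
  · rw [D_D_eq hh hh₁ hz]
    unfold linCoef linSource
    ring
  · rw [D_eq hh le_rfl, hk0, hbdef]
    simp
  · have h1 : Tendsto k atTop (𝓝 0) := by
      have h2 : Tendsto (fun z : ℝ => (z + 1) ^ (-s)) atTop (𝓝 0) :=
        (tendsto_rpow_neg_atTop hs0).comp (tendsto_atTop_add_const_right _ 1 tendsto_id)
      refine tendsto_of_tendsto_of_tendsto_of_le_of_le' (by simpa only [mul_zero] using h2.const_mul (-B))
        (by simpa only [mul_zero] using h2.const_mul B) ?_ ?_
      · filter_upwards [eventually_ge_atTop 0] with z hz using (hkb z hz).1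
      · filter_upwards [eventually_ge_atTop 0] with z hz using (hkb z hz).2
    have h2 := (tendsto_zero_of_isBigO_rpow (by linarith)
      (hshift (2 - del n) (by linarith))).const_mul (lam0 n)
    have h3 := h1.add h2
    simp only [mul_zero, add_zero] at h3
    refine h3.congr fun z => ?_
    simp only [phi2]
    ring

end

end ReactionFront

theorem proposition3p3 (n : ℕ) (hn : 4 ≤ n) :
    (∃ η : ℝ → ℝ, ReactionFront.IsEta n η) ∧
    ∀ η : ℝ → ℝ, ReactionFront.IsEta n η →
      ∃ h : ℝ → ℝ,
        ReactionFront.IsH n η h ∧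
        (∀ g : ℝ → ℝ, ReactionFront.IsH n η g → Set.EqOn g h (Set.Ici 0)) ∧
        (∃ h₀ h₂ : ℝ, ReactionFront.ExpansionAtZero h ![h₀, h₂] ![0, 2]) ∧
        (∃ lam' : ℝ, ReactionFront.ExpansionAtTop h
          ![ReactionFront.lam0 n, lam']
          ![ReactionFront.del n - 2, ReactionFront.del' n - 2]) := by
  refine ⟨ReactionFront.exists_isEta hn, fun η hη => ?_⟩
  obtain ⟨h, hh⟩ := hη.exists_isH hn
  exact ⟨h, hh, fun g hg => hh.eqOn hn hη hg,
    ⟨_, _, ReactionFront.expansionAtZero_of_deriv_zero hh.twiceDiff hh.deriv_zero⟩,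
    hh.exists_expansionAtTop hn hη⟩
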